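/- **Problem.** Let $f:\mathbb R^n\to\mathbb R$ and $c:\mathbb R^n\to\mathbb R^m$ be continuously differentiable and $0\le\bar m\le m$. Consider $$\min f(x)\quad\text{s.t.}\quad c_i(x)=0\ (i\le\bar m),\qquad c_i(x)\le 0\ (i>\bar m). \tag{NLP}$$ Put $v(x)=\sum_{i\le\bar m}|c_i(x)|+\sum_{i>\bar m}(c_i(x))_+$ and $\phi(x,\rho)=\rho f(x)+v(x)$. A point $x$ is *first-order stationary for $v$* if there is $\eta\in\mathbb R^m$ with $\sum_i\eta_i\nabla c_i(x)=0$ and $\eta_i\in\partial|\cdot|(c_i(x))$ for $i\le\bar m$, $\eta_i\in\partial(\cdot)_+(c_i(x))$ for $i>\bar m$. It is an *infeasible stationary point* if it is moreover infeasible. It is a *KKT point* if it is feasible and there is $\eta\in\mathbb R^m$ with $\nabla f(x)+\sum_i\eta_i\nabla c_i(x)=0$, $\eta_i\ge0$ for $i>\bar m$, and $\eta_ic_i(x)=0$ for all $i$. **Subproblems.** Let $X\subset\mathbb R^n$ be a set of admissible steps. At $x^k$ write $g=\nabla f(x^k)$, $a^i=\nabla c_i(x^k)$, $b_i=c_i(x^k)$,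 $\bar a^i=a^i/\|a^i\|_2$, $\bar b_i=b_i/\|a^i\|_2$, and $H_\rho=\rho H_f+H_0$, where the matrices $H_f=H_f^k$ and $H_0=H_0^k$ are approximations of $\nabla^2f(x^k)$ and $\sum_i\eta^k_i\nabla^2c_i(x^k)$ of any accuracy. Define $$l(d,\rho)=\rho\langle g,d\rangle+\sum_{i\le\bar m}|b_i+\langle a^i,d\rangle|+\sum_{i>\bar m}(b_i+\langle a^i,d\rangle)_+,\qquad \Delta l(d,\rho)=l(0,\rho)-l(d,\rho),$$ $J(d,\rho)=l(d,\rho)+\frac12\langle d,H_\rho d\rangle$ for $d\in X$ and $J(d,\rho)=+\infty$ otherwise, and $C_i=\{d:\langle\bar a^i,d\rangle+\bar b_i=0\}$ for $i\le\bar m$, $C_i=\{d:\langle\bar a^i,d\rangle+\bar b_i\le0\}$ for $i>\bar m$. With $\delta^*(y|C)=\sup_{d\in C}\langle y,d\rangle$, the dual objective of $\mathbf u=(u^0,\dots,u^{m+1})\in(\mathbb R^n)^{m+2}$ is $$D(\mathbf u,\rho)=-\tfrac12\langle u^0-\rho g,H_\rho^{-1}(u^0-\rho g)\rangle-\sum_{i=1}^m\|a^i\|_2\,\delta^*(u^i|C_i)-\delta^*(u^{m+1}|X).$$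 $\mathbf u$ is dual feasible if $u^0+\sum_{i=1}^m\|a^i\|_2u^i+u^{m+1}=0$ and $\|u^i\|_2\le1$ for $1\le i\le m$. Let $\zeta_i(\mathbf u)=\langle u^i,\bar a^i\rangle$. Let $\chi(d,\mathbf u)$ be the sum of $(1-\zeta_i(\mathbf u))\|a^i\|_2\operatorname{dist}(d,C_i)$ over all $i$ with $\langle\bar a^i,d\rangle+\bar b_i>0$ and of $(1+\zeta_i(\mathbf u))\|a^i\|_2\operatorname{dist}(d,C_i)$ over all $i\le\bar m$ with $\langle\bar a^i,d\rangle+\bar b_i<0$. **Algorithm.** The parameters are $\gamma,\theta_\rho,\theta_\alpha,\theta_\omega,\beta_v,\beta_\phi\in(0,1)$, $\beta_l\in(0,\beta_\phi(1-\beta_v)]$, $\rho_{-1}>0$ and $\omega_0>0$; $x^0,\eta^0$ are arbitrary. Iteration $k=0,1,2,\dots$ is as follows, where $H_\rho$ is positive definite for all $\rho\in[0,\rho_{k-1}]$. 1. Set $\rho_{(0)}=\rho_{k-1}$. An inner solver produces, for $j=0,1,\dots$, a step $d^{(j)}\in X$ and dual feasible $\mathbf u^{(j)},\mathbf w^{(j)}$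 with $J(d^{(j)},\rho_{(j)})\le J(0,\rho_{(j)})$ and $D(\mathbf w^{(j)},0)\ge D(\mathbf u^{(j)},0)\ge D(\mathbf u^{(0)},0)>-\infty$. With $J_\omega=l(0,0)+\omega_k$, consider the conditions $$(R_\phi)\ \frac{J_\omega-J(d^{(j)},\rho_{(j)})}{J_\omega-D(\mathbf u^{(j)},\rho_{(j)})}\ge\beta_\phi,\qquad (R_c)\ 1-\sqrt{\frac{\chi(d^{(j)},\mathbf u^{(j)})}{J_\omega}}\ge\beta_v,\qquad (R_v)\ \frac{J_\omega-l(d^{(j)},0)}{J_\omega-(D(\mathbf w^{(j)},0))_+}\ge\beta_v.$$ (DUST) If all three hold, the inner loop terminates; if $(R_\phi)$ and $(R_c)$ hold but $(R_v)$ does not, then $\rho_{(j+1)}=\theta_\rho\rho_{(j)}$; otherwise $\rho_{(j+1)}=\rho_{(j)}$. At the terminating $j$ set $d^k=d^{(j)}$ and $\tilde\rho_k=\rho_{(j)}$. 2. (PSST) Choose $\rho_k\in(0,\tilde\rho_k]$: $\rho_k=\tilde\rho_k$ if $\Delta l(d^k,\tilde\rho_k)+\omega_k\ge\beta_l(\Delta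 l(d^k,0)+\omega_k)$, and otherwise $$\rho_k=\frac{(1-\beta_l)(\Delta l(d^k,0)+\omega_k)}{\langle\nabla f(x^k),d^k\rangle+\frac12\langle d^k,H_{\rho_k}d^k\rangle}.$$ 3. Let $\alpha_k$ be the largest element of $\{\gamma^0,\gamma^1,\dots\}$ with $\phi(x^k+\alpha_kd^k,\rho_k)-\phi(x^k,\rho_k)\le-\theta_\alpha\alpha_k\Delta l(d^k,\rho_k)$. 4. Choose $\omega_{k+1}\in(0,\theta_\omega\omega_k]$, set $x^{k+1}=x^k+\alpha_kd^k$, and choose $\eta^{k+1}\in\mathbb R^m$. **Assumption.** The algorithm generates an infinite sequence $\{x^k\}$ (every inner loop and every line search terminates). The set $X$ is compact and convex with $0\in\operatorname{int}X$. There are constants $0<\underline\Lambda\le\overline\Lambda$ and $K_0>0$ such that: (a) on some open convex set containing all $x^k$ and $x^k+d^k$, the functions $f$ and $c_i$ are twice differentiable and bounded, with bounded first and second derivatives; (b) for all $k$ and all $\rho\in[0,\rho_0]$, where $\rho_0$ is the value $\rho_k$ for $k=0$, the eigenvalues of $H_\rho$ at iteration $k$ lie in $[\underline\Lambda,\overline\Lambda]$;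 (c) $\|\mathbf u^{(j)}\|_2\le K_0$ and $\|\mathbf w^{(j)}\|_2\le K_0$ for all inner iterates of all iterations $k$; (d) $\|\nabla c_i(x^k)\|_2>0$ for all $k$ and $i$; (e) $\{\eta^k\}$ is bounded. **Theorem.** Under this assumption: (i) Every limit point of $\{x^k\}$ is first-order stationary for $v$, i.e. it is feasible or an infeasible stationary point for (NLP). (ii) If $\rho_k\to\rho_*$ for some $\rho_*>0$ and $v(x^k)\to0$, then every limit point $x^*$ of $\{x^k\}$ with $v(x^*)=0$ is a KKT point for (NLP). (iii) If $\rho_k\to0$, then either all limit points of $\{x^k\}$ are feasible for (NLP) or all are infeasible. -/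

import Mathlib

noncomputable section

/-- Data of the problem `min f(x)` subject to `c i x = 0` for the first `mbar` indices `i` and
`c i x ≤ 0` for the remaining ones. -/
structure NLP (n m : ℕ) where
  f : EuclideanSpace ℝ (Fin n) → ℝ
  c : Fin m → EuclideanSpace ℝ (Fin n) → ℝ
  mbar : ℕ
  mbar_le : mbar ≤ m

/-- The violation `|t|` of an equality (`i < mbar`) or `(t)₊` of an inequality. -/
def constraintViolation {m : ℕ} (mbar : ℕ) (i : Fin m) (t : ℝ) : ℝ :=
  if i.val < mbar then |t| else max t 0

namespace NLP

variable {n m : ℕ}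

/-- The measure of infeasibility. -/
def v (P : NLP n m) (x : EuclideanSpace ℝ (Fin n)) : ℝ :=
  ∑ i, constraintViolation P.mbar i (P.c i x)

/-- The exact penalty function. -/
def phi (P : NLP n m) (x : EuclideanSpace ℝ (Fin n)) (ρ : ℝ) : ℝ := ρ * P.f x + P.v x

def IsFeasible (P : NLP n m) (x : EuclideanSpace ℝ (Fin n)) : Prop :=
  ∀ i : Fin m, if i.val < P.mbar then P.c i x = 0 else P.c i x ≤ 0

/-- First-order stationarity for `v`: zero is a combination of the constraint gradients whose
coefficients are subgradients of the violation terms at the constraint values. -/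
def IsStationaryForViolation (P : NLP n m) (x : EuclideanSpace ℝ (Fin n)) : Prop :=
  ∃ η : Fin m → ℝ, ∑ i, η i • gradient (P.c i) x = 0 ∧
    ∀ i : Fin m,
      (P.c i x > 0 → η i = 1) ∧
      (P.c i x < 0 → η i = if i.val < P.mbar then -1 else 0) ∧
      (P.c i x = 0 → (if i.val < P.mbar then -1 else 0) ≤ η i ∧ η i ≤ 1)

def IsInfeasibleStationary (P : NLP n m) (x : EuclideanSpace ℝ (Fin n)) : Prop :=
  ¬ P.IsFeasible x ∧ P.IsStationaryForViolation x

def IsKKT (P : NLP n m) (x : EuclideanSpace ℝ (Fin n)) : Prop :=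
  P.IsFeasible x ∧ ∃ η : Fin m → ℝ,
    gradient P.f x + ∑ i, η i • gradient (P.c i) x = 0 ∧
    (∀ i : Fin m, P.mbar ≤ i.val → 0 ≤ η i) ∧
    ∀ i : Fin m, η i * P.c i x = 0

end NLP

/-- The extended-real-valued support function of a set. -/
def supportFunction {n : ℕ} (C : Set (EuclideanSpace ℝ (Fin n)))
    (y : EuclideanSpace ℝ (Fin n)) : EReal :=
  ⨆ d ∈ C, ((inner ℝ y d : ℝ) : EReal)

/-- The quadratic form `⟨d, M d⟩`. -/
def quadForm {n : ℕ} (M : Matrix (Fin n) (Fin n) ℝ) (d : EuclideanSpace ℝ (Fin n)) : ℝ :=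
  d.ofLp ⬝ᵥ M.mulVec d.ofLp

/-- A dual vector `(u⁰, u¹, …, uᵐ, uᵐ⁺¹)`. -/
structure DualVec (n m : ℕ) where
  first : EuclideanSpace ℝ (Fin n)
  mid : Fin m → EuclideanSpace ℝ (Fin n)
  last : EuclideanSpace ℝ (Fin n)

/-- The Euclidean norm on the product space. -/
def DualVec.norm2 {n m : ℕ} (u : DualVec n m) : ℝ :=
  √(‖u.first‖ ^ 2 + ∑ i, ‖u.mid i‖ ^ 2 + ‖u.last‖ ^ 2)

/-- Data of a quadratic subproblem: objective gradient `g`, constraint gradients `a` and values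
`b`, matrices `Hf` and `H0` (with `H_ρ = ρ Hf + H0`), and the set `X` of admissible steps. -/
structure QPData (n m : ℕ) where
  mbar : ℕ
  g : EuclideanSpace ℝ (Fin n)
  a : Fin m → EuclideanSpace ℝ (Fin n)
  b : Fin m → ℝ
  Hf : Matrix (Fin n) (Fin n) ℝ
  H0 : Matrix (Fin n) (Fin n) ℝ
  X : Set (EuclideanSpace ℝ (Fin n))

namespace QPData

variable {n m : ℕ}

def H (Q : QPData n m) (ρ : ℝ) : Matrix (Fin n) (Fin n) ℝ := ρ • Q.Hf + Q.H0

/-- The linearized model of the penalty function (without the constant `ρ f(x)`). -/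
def l (Q : QPData n m) (d : EuclideanSpace ℝ (Fin n)) (ρ : ℝ) : ℝ :=
  ρ * inner ℝ Q.g d + ∑ i, constraintViolation Q.mbar i (Q.b i + inner ℝ (Q.a i) d)

/-- The reduction in `l`. -/
def deltaL (Q : QPData n m) (d : EuclideanSpace ℝ (Fin n)) (ρ : ℝ) : ℝ := Q.l 0 ρ - Q.l d ρ

open Classical in
/-- The local model of the penalty function, equal to `+∞` outside `X`. -/
def J (Q : QPData n m) (d : EuclideanSpace ℝ (Fin n)) (ρ : ℝ) : EReal :=
  ((Q.l d ρ + quadForm (Q.H ρ) d / 2 : ℝ) : EReal) + (if d ∈ Q.X then 0 else ⊤)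

def abar (Q : QPData n m) (i : Fin m) : EuclideanSpace ℝ (Fin n) := ‖Q.a i‖⁻¹ • Q.a i

def bbar (Q : QPData n m) (i : Fin m) : ℝ := Q.b i / ‖Q.a i‖

/-- The hyperplane (equality) or half space (inequality) of the `i`-th linearized constraint. -/
def C (Q : QPData n m) (i : Fin m) : Set (EuclideanSpace ℝ (Fin n)) :=
  if i.val < Q.mbar then {d | inner ℝ (Q.abar i) d + Q.bbar i = 0}
  else {d | inner ℝ (Q.abar i) d + Q.bbar i ≤ 0}

/-- The constraints of the dual subproblem. -/
def IsDualFeasible (Q : QPData n m) (u : DualVec n m) : Prop :=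
  u.first + ∑ i, ‖Q.a i‖ • u.mid i + u.last = 0 ∧ ∀ i, ‖u.mid i‖ ≤ 1

/-- The dual objective; it may be `-∞`. -/
def D (Q : QPData n m) (u : DualVec n m) (ρ : ℝ) : EReal :=
  ((-(quadForm (Q.H ρ)⁻¹ (u.first - ρ • Q.g) / 2) : ℝ) : EReal)
    - ∑ i, (‖Q.a i‖ : EReal) * supportFunction (Q.C i) (u.mid i)
    - supportFunction Q.X u.last

def zeta (Q : QPData n m) (u : DualVec n m) (i : Fin m) : ℝ := inner ℝ (u.mid i) (Q.abar i)

/-- The complementarity measure: indices with positive residual have weight `1 - ζᵢ`, equalities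
with negative residual have weight `1 + ζᵢ`, all others do not contribute. -/
def chi (Q : QPData n m) (d : EuclideanSpace ℝ (Fin n)) (u : DualVec n m) : ℝ :=
  ∑ i : Fin m,
    if inner ℝ (Q.abar i) d + Q.bbar i > 0 then
      (1 - Q.zeta u i) * ‖Q.a i‖ * Metric.infDist d (Q.C i)
    else if i.val < Q.mbar ∧ inner ℝ (Q.abar i) d + Q.bbar i < 0 then
      (1 + Q.zeta u i) * ‖Q.a i‖ * Metric.infDist d (Q.C i)
    else 0

/-- `J⁽⁰⁾ + ω`, where `J⁽⁰⁾ = l(0, 0)`. -/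
def J0ω (Q : QPData n m) (ω : ℝ) : ℝ := Q.l 0 0 + ω

def rv (Q : QPData n m) (ω : ℝ) (d : EuclideanSpace ℝ (Fin n)) (w : DualVec n m) : EReal :=
  ((Q.J0ω ω - Q.l d 0 : ℝ) : EReal) / ((Q.J0ω ω : EReal) - max (Q.D w 0) 0)

def rphi (Q : QPData n m) (ω ρ : ℝ) (d : EuclideanSpace ℝ (Fin n)) (u : DualVec n m) : EReal :=
  ((Q.J0ω ω : EReal) - Q.J d ρ) / ((Q.J0ω ω : EReal) - Q.D u ρ)

def rc (Q : QPData n m) (ω : ℝ) (d : EuclideanSpace ℝ (Fin n)) (u : DualVec n m) : ℝ :=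
  1 - √(Q.chi d u / Q.J0ω ω)

end QPData

/-- The parameters of the algorithm; `ρInit` is the initial penalty parameter `ρ₋₁`. -/
structure SQPParams where
  γ : ℝ
  θρ : ℝ
  θα : ℝ
  θω : ℝ
  βv : ℝ
  βφ : ℝ
  βl : ℝ
  ρInit : ℝ

structure SQPParams.Valid (p : SQPParams) : Prop where
  γ_mem : p.γ ∈ Set.Ioo (0 : ℝ) 1
  θρ_mem : p.θρ ∈ Set.Ioo (0 : ℝ) 1
  θα_mem : p.θα ∈ Set.Ioo (0 : ℝ) 1
  θω_mem : p.θω ∈ Set.Ioo (0 : ℝ) 1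
  βv_mem : p.βv ∈ Set.Ioo (0 : ℝ) 1
  βφ_mem : p.βφ ∈ Set.Ioo (0 : ℝ) 1
  βl_mem : p.βl ∈ Set.Ioc (0 : ℝ) (p.βφ * (1 - p.βv))
  ρInit_pos : 0 < p.ρInit

/-- Everything an execution produces. In outer iteration `k` the subproblem solver performs the
inner iterations `j = 0, …, N k` with iterates `(dIn k j, uIn k j, wIn k j)` and penalty parameters
`ρIn k j`. `Hf k` and `H0 k` are the approximations, used at the iterate `(x k, η k)`, of the
Hessians of `f` and of `∑ i, η k i * c i`; no accuracy is required of them. -/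
structure SQPRun (n m : ℕ) where
  x : ℕ → EuclideanSpace ℝ (Fin n)
  η : ℕ → EuclideanSpace ℝ (Fin m)
  Hf : ℕ → Matrix (Fin n) (Fin n) ℝ
  H0 : ℕ → Matrix (Fin n) (Fin n) ℝ
  ω : ℕ → ℝ
  N : ℕ → ℕ
  dIn : ℕ → ℕ → EuclideanSpace ℝ (Fin n)
  uIn : ℕ → ℕ → DualVec n m
  wIn : ℕ → ℕ → DualVec n m
  ρIn : ℕ → ℕ → ℝ
  ρ : ℕ → ℝ
  α : ℕ → ℝ

namespace SQPRun

variable {n m : ℕ}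

/-- The search direction `dᵏ`, the last inner iterate. -/
def d (R : SQPRun n m) (k : ℕ) : EuclideanSpace ℝ (Fin n) := R.dIn k (R.N k)

/-- The penalty parameter at the end of the `k`-th inner loop. -/
def ρTilde (R : SQPRun n m) (k : ℕ) : ℝ := R.ρIn k (R.N k)

/-- The subproblem data in the `k`-th iteration. -/
def qp (R : SQPRun n m) (P : NLP n m) (X : Set (EuclideanSpace ℝ (Fin n))) (k : ℕ) :
    QPData n m where
  mbar := P.mbar
  g := gradient P.f (R.x k)
  a := fun i => gradient (P.c i) (R.x k)
  b := fun i => P.c i (R.x k)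
  Hf := R.Hf k
  H0 := R.H0 k
  X := X

/-- The penalty parameter `ρ_{k-1}` with which the `k`-th iteration starts. -/
def ρPrev (R : SQPRun n m) (p : SQPParams) : ℕ → ℝ
  | 0 => p.ρInit
  | k + 1 => R.ρ k

/-- Condition on the ratio `r_v` at inner iteration `j`. -/
def Rv (R : SQPRun n m) (P : NLP n m) (X : Set (EuclideanSpace ℝ (Fin n))) (p : SQPParams)
    (k j : ℕ) : Prop :=
  (R.qp P X k).rv (R.ω k) (R.dIn k j) (R.wIn k j) ≥ (p.βv : EReal)

/-- Condition on the ratio `r_φ` at inner iteration `j`. -/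
def Rphi (R : SQPRun n m) (P : NLP n m) (X : Set (EuclideanSpace ℝ (Fin n))) (p : SQPParams)
    (k j : ℕ) : Prop :=
  (R.qp P X k).rphi (R.ω k) (R.ρIn k j) (R.dIn k j) (R.uIn k j) ≥ (p.βφ : EReal)

/-- Condition on the ratio `r_c` at inner iteration `j`. -/
def Rc (R : SQPRun n m) (P : NLP n m) (X : Set (EuclideanSpace ℝ (Fin n))) (p : SQPParams)
    (k j : ℕ) : Prop :=
  (R.qp P X k).rc (R.ω k) (R.dIn k j) (R.uIn k j) ≥ p.βv

/-- What is required of the inner iterates of iteration `k`: primal and dual feasibility, and that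
they are no worse than the zero step and the initial dual estimate. -/
structure InnerFeasible (R : SQPRun n m) (P : NLP n m) (X : Set (EuclideanSpace ℝ (Fin n)))
    (k j : ℕ) : Prop where
  d_mem : R.dIn k j ∈ X
  u_feasible : (R.qp P X k).IsDualFeasible (R.uIn k j)
  w_feasible : (R.qp P X k).IsDualFeasible (R.wIn k j)
  primal_no_worse : (R.qp P X k).J (R.dIn k j) (R.ρIn k j) ≤ (R.qp P X k).J 0 (R.ρIn k j)
  w_no_worse : (R.qp P X k).D (R.uIn k j) 0 ≤ (R.qp P X k).D (R.wIn k j) 0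
  u_no_worse : (R.qp P X k).D (R.uIn k 0) 0 ≤ (R.qp P X k).D (R.uIn k j) 0
  u_init_finite : ⊥ < (R.qp P X k).D (R.uIn k 0) 0

/-- The dynamic updating strategy for the penalty parameter inside the `k`-th inner loop, which
terminates at its iteration `N k`. -/
structure DUST (R : SQPRun n m) (P : NLP n m) (X : Set (EuclideanSpace ℝ (Fin n)))
    (p : SQPParams) (k : ℕ) : Prop where
  terminate : R.Rphi P X p k (R.N k) ∧ R.Rc P X p k (R.N k) ∧ R.Rv P X p k (R.N k)
  continue_ : ∀ j < R.N k, ¬ (R.Rphi P X p k j ∧ R.Rc P X p k j ∧ R.Rv P X p k j)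
  reduce : ∀ j < R.N k, R.Rphi P X p k j ∧ R.Rc P X p k j →
    R.ρIn k (j + 1) = p.θρ * R.ρIn k j
  keep : ∀ j < R.N k, ¬ (R.Rphi P X p k j ∧ R.Rc P X p k j) → R.ρIn k (j + 1) = R.ρIn k j

/-- The model reduction condition of the posterior strategy for a penalty parameter `r`. -/
def PosteriorCondition (R : SQPRun n m) (P : NLP n m) (X : Set (EuclideanSpace ℝ (Fin n)))
    (p : SQPParams) (k : ℕ) (r : ℝ) : Prop :=
  (R.qp P X k).deltaL (R.d k) r + R.ω k ≥ p.βl * ((R.qp P X k).deltaL (R.d k) 0 + R.ω k)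

/-- The posterior subproblem strategy choosing `ρ k ∈ (0, ρTilde k]`. -/
structure PSST (R : SQPRun n m) (P : NLP n m) (X : Set (EuclideanSpace ℝ (Fin n)))
    (p : SQPParams) (k : ℕ) : Prop where
  pos : 0 < R.ρ k
  le : R.ρ k ≤ R.ρTilde k
  keep : R.PosteriorCondition P X p k (R.ρTilde k) → R.ρ k = R.ρTilde k
  reduce : ¬ R.PosteriorCondition P X p k (R.ρTilde k) →
    R.ρ k = (1 - p.βl) * ((R.qp P X k).deltaL (R.d k) 0 + R.ω k) /
      (inner ℝ (gradient P.f (R.x k)) (R.d k) + quadForm ((R.qp P X k).H (R.ρ k)) (R.d k) / 2)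

/-- The sufficient decrease condition for a stepsize `t`. -/
def SufficientDecrease (R : SQPRun n m) (P : NLP n m) (X : Set (EuclideanSpace ℝ (Fin n)))
    (p : SQPParams) (k : ℕ) (t : ℝ) : Prop :=
  P.phi (R.x k + t • R.d k) (R.ρ k) - P.phi (R.x k) (R.ρ k) ≤
    -p.θα * t * (R.qp P X k).deltaL (R.d k) (R.ρ k)

/-- `R` is an (infinite) execution of the penalty-SQP algorithm with DUST and PSST. -/
structure IsExecution (R : SQPRun n m) (P : NLP n m) (X : Set (EuclideanSpace ℝ (Fin n)))
    (p : SQPParams) : Prop where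
  ω_zero_pos : 0 < R.ω 0
  posDef : ∀ k, ∀ r ∈ Set.Icc 0 (R.ρPrev p k), ((R.qp P X k).H r).PosDef
  ρIn_zero : ∀ k, R.ρIn k 0 = R.ρPrev p k
  inner_feasible : ∀ k, ∀ j ≤ R.N k, R.InnerFeasible P X k j
  dust : ∀ k, R.DUST P X p k
  psst : ∀ k, R.PSST P X p k
  line_search : ∀ k, ∃ s : ℕ, R.α k = p.γ ^ s ∧ R.SufficientDecrease P X p k (p.γ ^ s) ∧
    ∀ t < s, ¬ R.SufficientDecrease P X p k (p.γ ^ t)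
  ω_succ : ∀ k, R.ω (k + 1) ∈ Set.Ioc 0 (p.θω * R.ω k)
  x_succ : ∀ k, R.x (k + 1) = R.x k + R.α k • R.d k

/-- `h` and its first and second derivatives exist and are bounded on `Ω`. -/
def BoundedDerivatives (h : EuclideanSpace ℝ (Fin n) → ℝ)
    (Ω : Set (EuclideanSpace ℝ (Fin n))) : Prop :=
  DifferentiableOn ℝ h Ω ∧ DifferentiableOn ℝ (fderiv ℝ h) Ω ∧
    ∃ M : ℝ, ∀ y ∈ Ω, |h y| ≤ M ∧ ‖fderiv ℝ h y‖ ≤ M ∧ ‖fderiv ℝ (fderiv ℝ h) y‖ ≤ M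

/-- The global assumption on the problem and the execution. The eigenvalues of the matrix
`H_r` are expressed through its spectrum. -/
structure GlobalAssumption (R : SQPRun n m) (P : NLP n m)
    (X : Set (EuclideanSpace ℝ (Fin n))) : Prop where
  compact : IsCompact X
  convex : Convex ℝ X
  zero_mem_interior : (0 : EuclideanSpace ℝ (Fin n)) ∈ interior X
  bounded_derivatives : ∃ Ω : Set (EuclideanSpace ℝ (Fin n)), IsOpen Ω ∧ Convex ℝ Ω ∧
    (∀ k, R.x k ∈ Ω ∧ R.x k + R.d k ∈ Ω) ∧
    BoundedDerivatives P.f Ω ∧ ∀ i, BoundedDerivatives (P.c i) Ω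
  eigenvalue_bounds : ∃ Λlow Λup : ℝ, 0 < Λlow ∧ Λlow ≤ Λup ∧
    ∀ k, ∀ r ∈ Set.Icc 0 (R.ρ 0), spectrum ℝ ((R.qp P X k).H r) ⊆ Set.Icc Λlow Λup
  dual_bounded : ∃ K0 : ℝ, 0 < K0 ∧ ∀ k, ∀ j ≤ R.N k,
    (R.uIn k j).norm2 ≤ K0 ∧ (R.wIn k j).norm2 ≤ K0
  gradient_pos : ∀ k i, 0 < ‖gradient (P.c i) (R.x k)‖
  multipliers_bounded : ∃ K : ℝ, ∀ k, ‖R.η k‖ ≤ K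

end SQPRun

end

/-! The argument combines a descent argument for the penalty function with dual bounds on the
subproblems.

Descent. Shift `f` by a bound `M` so that Ψₖ = ρₖ(f(xᵏ) + M) + v(xᵏ) is nonnegative; reducing ρ can
then only lower Ψ. The line search decreases Ψ by θα αₖ δₖ with δₖ = Δl(dᵏ, ρₖ). The posterior
condition gives δₖ ≥ -ωₖ with ∑ ωₖ finite, and a Taylor estimate shows that αₖ is 1 or at least a
fixed multiple of δₖ when δₖ > 0. Hence Ψₖ converges and δₖ → 0 (`tendsto_of_quasi_decrease`,
`tendsto_reduction`). If ρₖ → 0, the part with `f` vanishes, so v(xᵏ) converges and v takes one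
value at all limit points: this is (iii).

Duality. By the posterior condition Δl(dᵏ, 0) + ωₖ → 0 as well. The ratio tests bound the gaps
between v(xᵏ) and the dual values by such reductions: (R_v) at ρ = 0 for w, once v stays away from
0, and (R_φ) at ρ̃ₖ for u. A finite dual value forces uⁱ to be ζᵢ āⁱ with ζᵢ an admissible
multiplier, and the gap then dominates three nonnegative quantities: a multiple of ‖u⁰ - ρg‖², the
complementarity defects of the ζᵢ, and r‖uᵐ⁺¹‖ for a ball of radius r inside X
(`IsProperDual.gap_le`). When the gap vanishes, the dual constraint becomes a multiplier equation at
the limit point (`exists_multiplier_of_gap`). With ρ = 0 it is stationarity for v, which is (i);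
with ρ → ρ_* > 0 it gives a KKT point after division by ρ_*, which is (ii). -/

section Convergence

open Filter Topology

/-! ### The violation terms `|t|` and `(t)₊` -/

section Violation

variable {m : ℕ} (mbar : ℕ) (i : Fin m)

theorem constraintViolation_nonneg (t : ℝ) : 0 ≤ constraintViolation mbar i t := by
  unfold constraintViolation
  split_ifs <;> simp

theorem constraintViolation_le_add_abs_sub (s t : ℝ) :
    constraintViolation mbar i s ≤ constraintViolation mbar i t + |s - t| := by
  unfold constraintViolation
  have h := le_abs_self (s - t)
  split_ifs
  · have := abs_add_le t (s - t)
    simpa using this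
  · have := le_max_left t 0
    have := le_max_right t 0
    have := abs_nonneg (s - t)
    exact max_le (by linarith) (by linarith)

theorem constraintViolation_convex (b s : ℝ) {t : ℝ} (h0 : 0 ≤ t) (h1 : t ≤ 1) :
    constraintViolation mbar i (b + t * s) ≤
      (1 - t) * constraintViolation mbar i b + t * constraintViolation mbar i (b + s) := by
  have h1' : 0 ≤ 1 - t := by linarith
  have e : b + t * s = (1 - t) * b + t * (b + s) := by ring
  unfold constraintViolation
  split_ifs
  · rw [e]
    refine (abs_add_le _ _).trans ?_
    rw [abs_mul, abs_mul, abs_of_nonneg h0, abs_of_nonneg h1']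
  · rw [e]
    have a1 := mul_le_mul_of_nonneg_left (le_max_left b 0) h1'
    have a2 := mul_le_mul_of_nonneg_left (le_max_left (b + s) 0) h0
    have a3 := mul_nonneg h1' (le_max_right b 0)
    have a4 := mul_nonneg h0 (le_max_right (b + s) 0)
    exact max_le (by linarith) (by linarith)

/-- The violation is the support function of the interval `[-1, 1]` or `[0, 1]`, which contains `z`.
-/
theorem mul_le_constraintViolation {z : ℝ} (hz : |z| ≤ 1) (hz0 : mbar ≤ i.val → 0 ≤ z) (b : ℝ) :
    z * b ≤ constraintViolation mbar i b := by
  obtain ⟨h1, h2⟩ := abs_le.1 hz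
  unfold constraintViolation
  split_ifs with h
  · calc z * b ≤ |z * b| := le_abs_self _
      _ = |z| * |b| := abs_mul _ _
      _ ≤ |b| := mul_le_of_le_one_left (abs_nonneg _) hz
  · have := hz0 (not_lt.1 h)
    rcases le_total b 0 with hb | hb
    · exact (mul_nonpos_of_nonneg_of_nonpos this hb).trans (le_max_right _ _)
    · exact (mul_le_of_le_one_left hb h2).trans (le_max_left _ _)

theorem continuous_constraintViolation : Continuous (constraintViolation mbar i) := by
  unfold constraintViolation
  split_ifs <;> fun_prop

end Violation

/-! ### Quadratic forms of positive definite matrices -/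

theorem quadForm_nonneg {n : ℕ} {M : Matrix (Fin n) (Fin n) ℝ} (h : M.PosDef)
    (d : EuclideanSpace ℝ (Fin n)) : 0 ≤ quadForm M d := by
  simpa [quadForm] using h.posSemidef.dotProduct_mulVec_nonneg d.ofLp

/-- A bound on the eigenvalues of a positive definite matrix bounds its inverse from below. -/
theorem le_quadForm_inv {n : ℕ} {M : Matrix (Fin n) (Fin n) ℝ} (h : M.PosDef) {L : ℝ}
    (hL : 0 < L) (hs : ∀ t ∈ spectrum ℝ M, t ≤ L) (y : EuclideanSpace ℝ (Fin n)) :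
    ‖y‖ ^ 2 / L ≤ quadForm M⁻¹ y := by
  have hu : IsUnit M := h.isUnit
  have hA : (M⁻¹ - L⁻¹ • (1 : Matrix (Fin n) (Fin n) ℝ)).IsHermitian :=
    h.inv.isHermitian.sub (by simp [Matrix.IsHermitian])
  have hP : (M⁻¹ - L⁻¹ • (1 : Matrix (Fin n) (Fin n) ℝ)).PosSemidef := by
    rw [hA.posSemidef_iff_eigenvalues_nonneg]
    intro j
    have hj := hA.eigenvalues_mem_spectrum_real j
    set μ := hA.eigenvalues j
    -- Subtracting a scalar shifts the spectrum, so μ = a - L⁻¹ with a an eigenvalue of `M⁻¹`; then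
    -- a⁻¹ is an eigenvalue of `M`, hence at most L.
    rw [← Algebra.algebraMap_eq_smul_one, ← spectrum.sub_singleton_eq] at hj
    obtain ⟨a, ha, b, hb, hab⟩ := Set.mem_sub.1 hj
    rw [Set.mem_singleton_iff] at hb
    have hapos : 0 < a := by
      obtain ⟨i, rfl⟩ := (h.inv.isHermitian.spectrum_real_eq_range_eigenvalues ▸ ha)
      exact h.inv.eigenvalues_pos i
    have hainv : a⁻¹ ∈ spectrum ℝ M := by
      obtain ⟨v, rfl⟩ := hu
      have h2 : a ∈ spectrum ℝ (↑v⁻¹ : Matrix (Fin n) (Fin n) ℝ) := by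
        simpa [Matrix.coe_units_inv] using ha
      have h3 := (spectrum.inv_mem_iff (r := Units.mk0 a hapos.ne') (a := v⁻¹)).1 (by simpa using h2)
      simpa using h3
    have := hs _ hainv
    have : L⁻¹ ≤ a := (inv_le_comm₀ hapos hL).1 this
    simp only [Pi.zero_apply]
    linarith
  have := hP.dotProduct_mulVec_nonneg y.ofLp
  simp only [star_trivial, Matrix.sub_mulVec, dotProduct_sub, Matrix.smul_mulVec,
    Matrix.one_mulVec, dotProduct_smul, smul_eq_mul] at this
  have e : y.ofLp ⬝ᵥ y.ofLp = ‖y‖ ^ 2 := by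
    rw [EuclideanSpace.real_norm_sq_eq]
    simp [dotProduct, sq]
  rw [e] at this
  unfold quadForm
  rw [div_eq_inv_mul]
  linarith

theorem EReal.coe_sum {ι : Type*} (s : Finset ι) (f : ι → ℝ) :
    ((∑ i ∈ s, f i : ℝ) : EReal) = ∑ i ∈ s, (f i : EReal) := by
  classical
  induction s using Finset.induction_on with
  | empty => simp
  | insert a s ha ih => rw [Finset.sum_insert ha, Finset.sum_insert ha, EReal.coe_add, ih]

/-! ### Support functions -/

section Support

variable {n : ℕ}

theorem le_supportFunction {C : Set (EuclideanSpace ℝ (Fin n))} {d : EuclideanSpace ℝ (Fin n)}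
    (hd : d ∈ C) (y : EuclideanSpace ℝ (Fin n)) :
    ((inner ℝ y d : ℝ) : EReal) ≤ supportFunction C y :=
  le_iSup₂ (f := fun d (_ : d ∈ C) => ((inner ℝ y d : ℝ) : EReal)) d hd

/-- A support function that is finite at `y` does not increase along `p` when the ray
`e + t p` stays in the set. -/
theorem inner_nonpos_of_supportFunction_ne_top {C : Set (EuclideanSpace ℝ (Fin n))}
    {y e p : EuclideanSpace ℝ (Fin n)} (hray : ∀ t : ℝ, 0 ≤ t → e + t • p ∈ C)
    (hy : supportFunction C y ≠ ⊤) : inner ℝ y p ≤ 0 := by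
  by_contra! hpos
  apply hy
  rw [EReal.eq_top_iff_forall_lt]
  intro s
  -- This parameter t makes ⟨y, e + t p⟩ equal to ⟨y, e⟩ + |s - ⟨y, e⟩| + 1, which exceeds s.
  have h0 : 0 ≤ (|s - inner ℝ y e| + 1) / inner ℝ y p := by positivity
  refine lt_of_lt_of_le ?_ (le_supportFunction (hray _ h0) y)
  rw [EReal.coe_lt_coe_iff, inner_add_right, inner_smul_right, div_mul_cancel₀ _ hpos.ne']
  linarith [le_abs_self (s - inner ℝ y e)]

theorem mul_norm_le_supportFunction {X : Set (EuclideanSpace ℝ (Fin n))} {r : ℝ} (hr : 0 ≤ r)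
    (hX : Metric.closedBall 0 r ⊆ X) (y : EuclideanSpace ℝ (Fin n)) :
    ((r * ‖y‖ : ℝ) : EReal) ≤ supportFunction X y := by
  by_cases hy : y = 0
  · have := le_supportFunction (hX (Metric.mem_closedBall_self hr)) y
    simpa [hy] using this
  have hn : ‖y‖ ≠ 0 := norm_ne_zero_iff.2 hy
  have hm : (r * ‖y‖⁻¹) • y ∈ X := hX (by
    rw [mem_closedBall_zero_iff, norm_smul, norm_mul, norm_inv, norm_norm, mul_assoc,
      inv_mul_cancel₀ hn, mul_one, Real.norm_of_nonneg hr])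
  refine le_trans ?_ (le_supportFunction hm y)
  rw [EReal.coe_le_coe_iff, inner_smul_right, real_inner_self_eq_norm_sq]
  apply le_of_eq
  field_simp

end Support

/-! ### Structure of dual vectors with finite dual value -/

namespace QPData

variable {n m : ℕ} (Q : QPData n m)

theorem inner_abar_self {i : Fin m} (h : 0 < ‖Q.a i‖) : inner ℝ (Q.abar i) (Q.abar i) = 1 := by
  rw [real_inner_self_eq_norm_sq, abar, norm_smul, norm_inv, norm_norm, inv_mul_cancel₀ h.ne',
    one_pow]

theorem mem_C_of_eq {i : Fin m} {d : EuclideanSpace ℝ (Fin n)}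
    (h : inner ℝ (Q.abar i) d + Q.bbar i = 0) : d ∈ Q.C i := by
  unfold C
  split_ifs
  · exact h
  · exact h.le

theorem neg_bbar_smul_abar_mem_C {i : Fin m} (h : 0 < ‖Q.a i‖) :
    -Q.bbar i • Q.abar i ∈ Q.C i :=
  Q.mem_C_of_eq (by rw [inner_smul_right, Q.inner_abar_self h]; ring)

theorem le_supportFunction_C {i : Fin m} (h : 0 < ‖Q.a i‖) (u : DualVec n m) :
    ((-Q.bbar i * Q.zeta u i : ℝ) : EReal) ≤ supportFunction (Q.C i) (u.mid i) := by
  refine le_trans (le_of_eq ?_) (le_supportFunction (Q.neg_bbar_smul_abar_mem_C h) (u.mid i))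
  rw [inner_smul_right]; rfl

/-- The component `p` of uⁱ orthogonal to āⁱ is a direction along which the bounding hyperplane, and
so `C i`, is invariant. Finiteness of the support function gives ⟨uⁱ, p⟩ = ‖p‖² ≤ 0. -/
theorem mid_eq_zeta_smul {i : Fin m} (h : 0 < ‖Q.a i‖) (u : DualVec n m)
    (hu : supportFunction (Q.C i) (u.mid i) ≠ ⊤) : u.mid i = Q.zeta u i • Q.abar i := by
  set p := u.mid i - Q.zeta u i • Q.abar i with hp
  have hperp : inner ℝ (Q.abar i) p = 0 := by
    rw [hp, inner_sub_right, inner_smul_right, Q.inner_abar_self h, zeta,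
      real_inner_comm (Q.abar i)]
    ring
  have hle := inner_nonpos_of_supportFunction_ne_top (e := -Q.bbar i • Q.abar i) (p := p)
    (fun t _ => Q.mem_C_of_eq (by
      rw [inner_add_right, inner_smul_right, inner_smul_right, Q.inner_abar_self h, hperp]
      ring)) hu
  have e : u.mid i = p + Q.zeta u i • Q.abar i := by rw [hp]; abel
  rw [e, inner_add_left, inner_smul_left, hperp, mul_zero, add_zero] at hle
  have hp0 : p = 0 := real_inner_self_nonpos.1 hle
  rw [e, hp0, zero_add]

/-- A half space recedes along -āⁱ, so a finite support function forces ⟨uⁱ, -āⁱ⟩ ≤ 0. -/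
theorem zeta_nonneg {i : Fin m} (h : 0 < ‖Q.a i‖) (hi : Q.mbar ≤ i.val) (u : DualVec n m)
    (hu : supportFunction (Q.C i) (u.mid i) ≠ ⊤) : 0 ≤ Q.zeta u i := by
  have hle := inner_nonpos_of_supportFunction_ne_top (e := -Q.bbar i • Q.abar i)
    (p := -Q.abar i) (fun t ht => by
      unfold C
      rw [if_neg (not_lt.2 hi), Set.mem_ofPred_eq, inner_add_right, inner_smul_right,
        inner_smul_right, inner_neg_right, Q.inner_abar_self h]
      linarith) hu
  rw [inner_neg_right] at hle
  unfold zeta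
  linarith

theorem abs_zeta_le {i : Fin m} (h : 0 < ‖Q.a i‖) {u : DualVec n m} (hu : ‖u.mid i‖ ≤ 1) :
    |Q.zeta u i| ≤ 1 := by
  have h1 : ‖Q.abar i‖ = 1 := by
    rw [abar, norm_smul, norm_inv, norm_norm, inv_mul_cancel₀ h.ne']
  have := abs_real_inner_le_norm (u.mid i) (Q.abar i)
  rw [h1, mul_one] at this
  exact this.trans hu

/-- The remaining support terms have real lower bounds, so the infinite one cannot be absorbed by
the convention `⊤ + ⊥ = ⊥`. -/
theorem D_eq_bot_of_eq_top (ha : ∀ i, 0 < ‖Q.a i‖) {u : DualVec n m} (ρ : ℝ) {i : Fin m}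
    (hi : supportFunction (Q.C i) (u.mid i) = ⊤) : Q.D u ρ = ⊥ := by
  have hsum : ∑ i, (‖Q.a i‖ : EReal) * supportFunction (Q.C i) (u.mid i) = ⊤ := by
    rw [← Finset.add_sum_erase _ _ (Finset.mem_univ i), hi, EReal.coe_mul_top_of_pos (ha i)]
    apply EReal.top_add_of_ne_bot
    apply ne_bot_of_le_ne_bot (b := ((∑ j ∈ Finset.univ.erase i,
      ‖Q.a j‖ * (-Q.bbar j * Q.zeta u j) : ℝ) : EReal)) (EReal.coe_ne_bot _)
    rw [EReal.coe_sum]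
    refine Finset.sum_le_sum fun j _ => ?_
    rw [EReal.coe_mul]
    exact mul_le_mul_of_nonneg_left (Q.le_supportFunction_C (ha j) u)
      (EReal.coe_nonneg.2 (norm_nonneg _))
  unfold D
  rw [hsum, EReal.sub_top, EReal.bot_sub]

/-- An explicit real upper bound of the dual objective. -/
theorem D_le (ha : ∀ i, 0 < ‖Q.a i‖) {r : ℝ} (hr : 0 ≤ r) (hX : Metric.closedBall 0 r ⊆ Q.X)
    (u : DualVec n m) (ρ : ℝ) :
    Q.D u ρ ≤ ((-(quadForm (Q.H ρ)⁻¹ (u.first - ρ • Q.g) / 2) + ∑ i, Q.zeta u i * Q.b i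
      - r * ‖u.last‖ : ℝ) : EReal) := by
  have hsum : ((-∑ i, Q.zeta u i * Q.b i : ℝ) : EReal) ≤
      ∑ i, (‖Q.a i‖ : EReal) * supportFunction (Q.C i) (u.mid i) := by
    rw [← Finset.sum_neg_distrib, EReal.coe_sum]
    refine Finset.sum_le_sum fun j _ => ?_
    have e : -(Q.zeta u j * Q.b j) = ‖Q.a j‖ * (-Q.bbar j * Q.zeta u j) := by
      have := (ha j).ne'
      unfold bbar
      field_simp
    rw [e, EReal.coe_mul]
    exact mul_le_mul_of_nonneg_left (Q.le_supportFunction_C (ha j) u)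
      (EReal.coe_nonneg.2 (norm_nonneg _))
  unfold D
  refine (EReal.sub_le_sub (EReal.sub_le_sub le_rfl hsum)
    (mul_norm_le_supportFunction hr hX u.last)).trans (le_of_eq ?_)
  rw [← EReal.coe_sub, ← EReal.coe_sub]
  congr 1
  ring

/-- A dual vector that satisfies the dual constraints and has a finite dual objective. -/
structure IsProperDual (u : DualVec n m) : Prop where
  sum_eq : u.first + ∑ i, Q.zeta u i • Q.a i + u.last = 0
  abs_le : ∀ i, |Q.zeta u i| ≤ 1
  nonneg : ∀ i, Q.mbar ≤ i.val → 0 ≤ Q.zeta u i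

theorem isProperDual (ha : ∀ i, 0 < ‖Q.a i‖) {u : DualVec n m} (hu : Q.IsDualFeasible u) {ρ : ℝ}
    (hD : Q.D u ρ ≠ ⊥) : Q.IsProperDual u := by
  have hne : ∀ i, supportFunction (Q.C i) (u.mid i) ≠ ⊤ := fun i hi =>
    hD (Q.D_eq_bot_of_eq_top ha ρ hi)
  refine ⟨?_, fun i => Q.abs_zeta_le (ha i) (hu.2 i), fun i hi => Q.zeta_nonneg (ha i) hi u (hne i)⟩
  rw [← hu.1]
  congr 2
  refine Finset.sum_congr rfl fun i _ => ?_
  conv_rhs => rw [Q.mid_eq_zeta_smul (ha i) u (hne i), abar, smul_smul, smul_smul, mul_comm ‖Q.a i‖,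
    mul_assoc, mul_inv_cancel₀ (ha i).ne', mul_one]

theorem IsProperDual.mul_le {Q : QPData n m} {u : DualVec n m} (h : Q.IsProperDual u) (i : Fin m) :
    Q.zeta u i * Q.b i ≤ constraintViolation Q.mbar i (Q.b i) :=
  mul_le_constraintViolation _ _ (h.abs_le i) (h.nonneg i) _

theorem l_zero (ρ : ℝ) : Q.l 0 ρ = ∑ i, constraintViolation Q.mbar i (Q.b i) := by
  simp [l]

/-- The gaps between the dual objective and the infeasibility measure. -/
theorem IsProperDual.gap_le {Q : QPData n m} {u : DualVec n m} (h : Q.IsProperDual u)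
    (ha : ∀ i, 0 < ‖Q.a i‖) {r : ℝ} (hr : 0 ≤ r) (hX : Metric.closedBall 0 r ⊆ Q.X) {ρ L : ℝ}
    (hH : (Q.H ρ).PosDef) (hL : 0 < L) (hs : ∀ t ∈ spectrum ℝ (Q.H ρ), t ≤ L) {ε : ℝ}
    (hε : ((Q.l 0 0 - ε : ℝ) : EReal) ≤ Q.D u ρ) :
    ‖u.first - ρ • Q.g‖ ^ 2 ≤ 2 * L * ε ∧ r * ‖u.last‖ ≤ ε ∧
      ∀ i, constraintViolation Q.mbar i (Q.b i) - Q.zeta u i * Q.b i ≤ ε := by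
  -- After `l_zero` this says that half the quadratic term, the sum of the complementarity defects
  -- and `r * ‖u.last‖` add up to at most ε. All three are nonnegative, so each is bounded by ε
  -- separately.
  have h1 := hε.trans (Q.D_le ha hr hX u ρ)
  rw [EReal.coe_le_coe_iff, l_zero] at h1
  have h2 := le_quadForm_inv hH hL hs (u.first - ρ • Q.g)
  have h3 : ∑ i, (constraintViolation Q.mbar i (Q.b i) - Q.zeta u i * Q.b i) =
    ∑ i, constraintViolation Q.mbar i (Q.b i) - ∑ i, Q.zeta u i * Q.b i :=
    Finset.sum_sub_distrib _ _
  have h4 : ∀ i ∈ Finset.univ, 0 ≤ constraintViolation Q.mbar i (Q.b i) - Q.zeta u i * Q.b i :=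
    fun i _ => sub_nonneg.2 (h.mul_le i)
  have h5 := Finset.sum_nonneg h4
  have h6 : 0 ≤ r * ‖u.last‖ := by positivity
  have h7 : 0 ≤ ‖u.first - ρ • Q.g‖ ^ 2 / L := by positivity
  refine ⟨?_, by linarith, fun i => ?_⟩
  · have : ‖u.first - ρ • Q.g‖ ^ 2 / L ≤ 2 * ε := by linarith
    rw [div_le_iff₀ hL] at this
    linarith
  · have := Finset.single_le_sum h4 (Finset.mem_univ i)
    linarith

/-- Weak duality at the zero step. -/
theorem IsProperDual.D_le_l_zero {Q : QPData n m} {u : DualVec n m} (h : Q.IsProperDual u)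
    (ha : ∀ i, 0 < ‖Q.a i‖) (hX : (0 : EuclideanSpace ℝ (Fin n)) ∈ Q.X) {ρ : ℝ}
    (hH : (Q.H ρ).PosDef) : Q.D u ρ ≤ (Q.l 0 0 : EReal) := by
  refine (Q.D_le ha le_rfl (by simpa using hX) u ρ).trans ?_
  rw [EReal.coe_le_coe_iff, l_zero]
  have := quadForm_nonneg hH.inv (u.first - ρ • Q.g)
  have := Finset.sum_le_sum fun i (_ : i ∈ Finset.univ) => h.mul_le i
  linarith

theorem deltaL_eq (d : EuclideanSpace ℝ (Fin n)) (ρ : ℝ) :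
    Q.deltaL d ρ = Q.deltaL d 0 - ρ * inner ℝ Q.g d := by
  simp [deltaL, l]
  ring

end QPData

/-! ### A Taylor estimate and a descent lemma for sequences -/

section Calculus

variable {n : ℕ}

theorem inner_gradient_eq (h : EuclideanSpace ℝ (Fin n) → ℝ) (x d : EuclideanSpace ℝ (Fin n)) :
    inner ℝ (gradient h x) d = fderiv ℝ h x d := by
  simp [gradient]

theorem ContDiff.continuous_gradient_of_one {h : EuclideanSpace ℝ (Fin n) → ℝ}
    (hh : ContDiff ℝ 1 h) : Continuous (gradient h) :=
  (LinearIsometryEquiv.continuous _).comp (hh.continuous_fderiv one_ne_zero)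

/-- First-order Taylor estimate. -/
theorem abs_sub_linearization_le {h : EuclideanSpace ℝ (Fin n) → ℝ}
    {Ω : Set (EuclideanSpace ℝ (Fin n))} (ho : IsOpen Ω) (hcv : Convex ℝ Ω) {M : ℝ}
    (h1 : DifferentiableOn ℝ h Ω) (h2 : DifferentiableOn ℝ (fderiv ℝ h) Ω)
    (hM : ∀ y ∈ Ω, ‖fderiv ℝ (fderiv ℝ h) y‖ ≤ M) {x d : EuclideanSpace ℝ (Fin n)} (hx : x ∈ Ω)
    (hd : x + d ∈ Ω) {t : ℝ} (ht0 : 0 ≤ t) (ht1 : t ≤ 1) :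
    |h (x + t • d) - h x - t * inner ℝ (gradient h x) d| ≤ M * ‖d‖ ^ 2 * t ^ 2 := by
  have hM0 : 0 ≤ M := (norm_nonneg (fderiv ℝ (fderiv ℝ h) x)).trans (hM x hx)
  have hz : x + t • d ∈ Ω := hcv.add_smul_mem hx hd ⟨ht0, ht1⟩
  have hseg : segment ℝ x (x + t • d) ⊆ Ω := hcv.segment_subset hx hz
  -- Mean value inequality for `h` minus its linearization: on the segment the derivative deviates
  -- from `fderiv ℝ h x` by at most `M * ‖t • d‖`.
  have key := (convex_segment (𝕜 := ℝ) x (x + t • d)).norm_image_sub_le_of_norm_hasFDerivWithin_le'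
    (f := h) (f' := fderiv ℝ h) (φ := fderiv ℝ h x) (C := M * ‖t • d‖)
    (fun y hy => ((h1.differentiableAt (ho.mem_nhds (hseg hy))).hasFDerivAt).hasFDerivWithinAt)
    (fun y hy => by
      refine (hcv.norm_image_sub_le_of_norm_fderiv_le (𝕜 := ℝ)
        (fun z hz => h2.differentiableAt (ho.mem_nhds hz)) hM hx (hseg hy)).trans ?_
      gcongr
      obtain ⟨a, ha, rfl⟩ := (segment_eq_image' ℝ x (x + t • d)) ▸ hy
      simp only [add_sub_cancel_left]
      rw [norm_smul, Real.norm_of_nonneg ha.1]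
      exact mul_le_of_le_one_left (norm_nonneg _) ha.2)
    (left_mem_segment _ _ _) (right_mem_segment _ _ _)
  rw [add_sub_cancel_left, map_smul, ← inner_gradient_eq, Real.norm_eq_abs, smul_eq_mul,
    norm_smul, Real.norm_of_nonneg ht0] at key
  exact key.trans (le_of_eq (by ring))

end Calculus

/-- A nonnegative sequence that decreases by `θ αₖ δₖ`, where `δₖ` is bounded below by a summable
error, converges, and `δₖ → 0` when the factors `αₖ` are not too small. -/
theorem tendsto_of_quasi_decrease {Ψ α δ ω : ℕ → ℝ} {θ c : ℝ} (hΨ : ∀ k, 0 ≤ Ψ k) (hθ : 0 < θ)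
    (hθ1 : θ ≤ 1) (hc : 0 < c) (hα0 : ∀ k, 0 ≤ α k) (hα1 : ∀ k, α k ≤ 1) (hω : ∀ k, 0 ≤ ω k)
    (hsum : Summable ω) (hδ : ∀ k, -ω k ≤ δ k) (hdec : ∀ k, Ψ (k + 1) ≤ Ψ k - θ * α k * δ k)
    (hstep : ∀ k, 0 < δ k → α k = 1 ∨ c * δ k ≤ α k) :
    (∃ L, Tendsto Ψ atTop (𝓝 L)) ∧ Tendsto δ atTop (𝓝 0) := by
  set S : ℕ → ℝ := fun k => ∑ j ∈ Finset.range k, ω j with hS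
  have hSl : Tendsto S atTop (𝓝 (∑' j, ω j)) := hsum.hasSum.tendsto_sum_nat
  have hSle : ∀ k, S k ≤ ∑' j, ω j := fun k => hsum.sum_le_tsum _ fun j _ => hω j
  -- Subtracting the partial sums of ω absorbs the possibly negative δ, because θ αₖ ≤ 1; hence Ψ -
  -- S is antitone.
  have hgap : ∀ k, θ * (α k * (δ k + ω k)) ≤ (Ψ k - S k) - (Ψ (k + 1) - S (k + 1)) := by
    intro k
    have e : S (k + 1) = S k + ω k := Finset.sum_range_succ _ _
    have h1 : θ * α k * ω k ≤ 1 * ω k :=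
      mul_le_mul_of_nonneg_right (mul_le_one₀ hθ1 (hα0 k) (hα1 k)) (hω k)
    have := hdec k
    rw [e]
    linarith
  have he : ∀ k, 0 ≤ α k * (δ k + ω k) := fun k => mul_nonneg (hα0 k) (by linarith [hδ k])
  have hanti : Antitone fun k => Ψ k - S k :=
    antitone_nat_of_succ_le fun k => by
      have := mul_nonneg hθ.le (he k)
      linarith [hgap k]
  have hbdd : BddBelow (Set.range fun k => Ψ k - S k) :=
    ⟨-∑' j, ω j, by
      rintro _ ⟨k, rfl⟩
      have := hΨ k
      have := hSle k
      show _ ≤ Ψ k - S k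
      linarith⟩
  have hZ := tendsto_atTop_ciInf hanti hbdd
  refine ⟨⟨_, by simpa using hZ.add hSl⟩, ?_⟩
  have hdiff : Tendsto (fun k => ((Ψ k - S k) - (Ψ (k + 1) - S (k + 1))) / θ) atTop (𝓝 0) := by
    simpa using (hZ.sub (hZ.comp (tendsto_add_atTop_nat 1))).div_const θ
  have hq : Tendsto (fun k => α k * (δ k + ω k)) atTop (𝓝 0) :=
    squeeze_zero he (fun k => by rw [le_div_iff₀ hθ]; linarith [hgap k]) hdiff
  -- With q = αₖ(δₖ + ωₖ), the case αₖ = 1 gives δₖ ≤ q, and the case c δₖ ≤ αₖ gives c δₖ² ≤ q. The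
  -- sum of both bounds serves either case.
  have hup : Tendsto (fun k => α k * (δ k + ω k) + √(α k * (δ k + ω k) / c)) atTop (𝓝 0) := by
    simpa using hq.add ((hq.div_const c).sqrt)
  have hlo : Tendsto (fun k => -ω k) atTop (𝓝 0) := by
    simpa using hsum.tendsto_atTop_zero.neg
  refine tendsto_of_tendsto_of_tendsto_of_le_of_le hlo hup hδ fun k => ?_
  have h0 := he k
  show δ k ≤ _
  rcases le_or_gt (δ k) 0 with hk | hk
  · exact hk.trans (by positivity)
  · have h1 : α k * δ k ≤ α k * (δ k + ω k) :=
      mul_le_mul_of_nonneg_left (by linarith [hω k]) (hα0 k)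
    rcases hstep k hk with h | h
    · rw [h, one_mul] at h1
      rw [h]
      have := Real.sqrt_nonneg (1 * (δ k + ω k) / c)
      linarith
    · have h2 : δ k ≤ √(α k * (δ k + ω k) / c) := by
        apply Real.le_sqrt_of_sq_le
        rw [le_div_iff₀ hc]
        have := mul_le_mul_of_nonneg_right h hk.le
        linarith
      linarith

/-! ### Real inequalities from the extended-real ratio tests -/

namespace QPData

variable {n m : ℕ} {Q : QPData n m}

theorem J0ω_sub_l (Q : QPData n m) (ω ρ : ℝ) (d : EuclideanSpace ℝ (Fin n)) :
    Q.J0ω ω - Q.l d ρ = Q.deltaL d ρ + ω := by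
  unfold J0ω deltaL
  rw [l_zero, l_zero]
  ring

theorem le_of_rv_ge {w : DualVec n m} {d : EuclideanSpace ℝ (Fin n)} {ω β : ℝ} (hω : 0 < ω)
    (hbot : Q.D w 0 ≠ ⊥) (hle : Q.D w 0 ≤ (Q.l 0 0 : EReal)) (h : Q.rv ω d w ≥ (β : EReal)) :
    ∃ t : ℝ, Q.D w 0 = t ∧ β * (Q.l 0 0 + ω - max t 0) ≤ Q.deltaL d 0 + ω := by
  lift Q.D w 0 to ℝ using ⟨ne_top_of_le_ne_top (EReal.coe_ne_top _) hle, hbot⟩ with t ht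
  refine ⟨t, rfl, ?_⟩
  rw [EReal.coe_le_coe_iff] at hle
  have h0 : 0 ≤ Q.l 0 0 := by
    rw [l_zero]
    exact Finset.sum_nonneg fun i _ => constraintViolation_nonneg _ _ _
  have hmax : max t 0 ≤ Q.l 0 0 := max_le hle h0
  rw [rv, ← ht, ← EReal.coe_zero, ← EReal.coe_strictMono.monotone.map_max, ← EReal.coe_sub,
    ← EReal.coe_div,
    ge_iff_le, EReal.coe_le_coe_iff, J0ω_sub_l, le_div_iff₀ (by unfold J0ω; linarith)] at h
  exact h

/-- Finiteness of the dual value comes from the test itself: at `⊥` the denominator is `⊤` and the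
ratio is 0 < β. Weak duality and ω > 0 then make the denominator positive. -/
theorem le_of_rphi_ge {u : DualVec n m} {d : EuclideanSpace ℝ (Fin n)} {ω ρ β : ℝ} (hω : 0 < ω)
    (hd : d ∈ Q.X) (hβ : 0 < β) (hle : Q.D u ρ ≠ ⊥ → Q.D u ρ ≤ (Q.l 0 0 : EReal))
    (h : Q.rphi ω ρ d u ≥ (β : EReal)) :
    ∃ t : ℝ, Q.D u ρ = t ∧
      β * (Q.l 0 0 + ω - t) ≤ Q.deltaL d ρ + ω - quadForm (Q.H ρ) d / 2 := by
  have hJ : (Q.J0ω ω : EReal) - Q.J d ρ =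
      ((Q.deltaL d ρ + ω - quadForm (Q.H ρ) d / 2 : ℝ) : EReal) := by
    rw [J, if_pos hd, add_zero, ← EReal.coe_sub, ← J0ω_sub_l]
    congr 1
    ring
  rw [rphi, hJ] at h
  have hbot : Q.D u ρ ≠ ⊥ := by
    intro hb
    rw [hb, EReal.coe_sub_bot, EReal.div_top, ge_iff_le, ← EReal.coe_zero,
      EReal.coe_le_coe_iff] at h
    linarith
  have hle := hle hbot
  lift Q.D u ρ to ℝ using ⟨ne_top_of_le_ne_top (EReal.coe_ne_top _) hle, hbot⟩ with t ht
  refine ⟨t, rfl, ?_⟩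
  rw [EReal.coe_le_coe_iff] at hle
  rw [← EReal.coe_sub, ← EReal.coe_div, ge_iff_le, EReal.coe_le_coe_iff,
    le_div_iff₀ (by unfold J0ω; linarith)] at h
  exact h

end QPData

/-! ### Estimates along an execution -/

namespace SQPRun

variable {n m : ℕ} {R : SQPRun n m} {P : NLP n m} {X : Set (EuclideanSpace ℝ (Fin n))}
  {p : SQPParams}

theorem l_zero_eq_v (k : ℕ) (ρ : ℝ) : (R.qp P X k).l 0 ρ = P.v (R.x k) := by
  rw [QPData.l_zero]; rfl

namespace IsExecution

theorem ρIn_pos_le (hR : R.IsExecution P X p) (hp : p.Valid) {k : ℕ} (h : 0 < R.ρPrev p k) {j : ℕ}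
    (hj : j ≤ R.N k) : 0 < R.ρIn k j ∧ R.ρIn k j ≤ R.ρPrev p k := by
  induction j with
  | zero => rw [hR.ρIn_zero]; exact ⟨h, le_rfl⟩
  | succ j ih =>
    obtain ⟨h1, h2⟩ := ih (by lia)
    by_cases hc : R.Rphi P X p k j ∧ R.Rc P X p k j
    · rw [(hR.dust k).reduce j (by lia) hc]
      exact ⟨mul_pos hp.θρ_mem.1 h1, (mul_le_of_le_one_left h1.le hp.θρ_mem.2.le).trans h2⟩
    · rw [(hR.dust k).keep j (by lia) hc]
      exact ⟨h1, h2⟩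

theorem ρPrev_pos (hR : R.IsExecution P X p) (hp : p.Valid) (k : ℕ) : 0 < R.ρPrev p k := by
  cases k with
  | zero => exact hp.ρInit_pos
  | succ k => exact (hR.psst k).pos

theorem ρTilde_pos_le (hR : R.IsExecution P X p) (hp : p.Valid) (k : ℕ) :
    0 < R.ρTilde k ∧ R.ρTilde k ≤ R.ρPrev p k :=
  hR.ρIn_pos_le hp (hR.ρPrev_pos hp k) le_rfl

theorem antitone_ρ (hR : R.IsExecution P X p) (hp : p.Valid) : Antitone R.ρ :=
  antitone_nat_of_succ_le fun k => (hR.psst (k + 1)).le.trans (hR.ρTilde_pos_le hp (k + 1)).2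

theorem ω_pos (hR : R.IsExecution P X p) (k : ℕ) : 0 < R.ω k := by
  cases k with
  | zero => exact hR.ω_zero_pos
  | succ k => exact (hR.ω_succ k).1

theorem summable_ω (hR : R.IsExecution P X p) (hp : p.Valid) : Summable R.ω := by
  have hle : ∀ k, R.ω k ≤ R.ω 0 * p.θω ^ k := by
    intro k
    induction k with
    | zero => simp
    | succ k ih =>
      have h1 := (hR.ω_succ k).2
      have h2 := mul_le_mul_of_nonneg_left ih hp.θω_mem.1.le
      rw [pow_succ]
      linarith
  exact Summable.of_nonneg_of_le (fun k => (hR.ω_pos k).le) hle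
    ((summable_geometric_of_lt_one hp.θω_mem.1.le hp.θω_mem.2).mul_left _)

theorem D_u_zero_ne_bot (hR : R.IsExecution P X p) (k : ℕ) :
    (R.qp P X k).D (R.uIn k (R.N k)) 0 ≠ ⊥ := by
  have h := hR.inner_feasible k (R.N k) le_rfl
  exact (h.u_init_finite.trans_le h.u_no_worse).ne'

theorem D_w_zero_ne_bot (hR : R.IsExecution P X p) (k : ℕ) :
    (R.qp P X k).D (R.wIn k (R.N k)) 0 ≠ ⊥ := by
  have h := hR.inner_feasible k (R.N k) le_rfl
  exact ((bot_lt_iff_ne_bot.2 (hR.D_u_zero_ne_bot k)).trans_le h.w_no_worse).ne'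

theorem isProperDual_u (hR : R.IsExecution P X p) (hA : R.GlobalAssumption P X) (k : ℕ) :
    (R.qp P X k).IsProperDual (R.uIn k (R.N k)) :=
  (R.qp P X k).isProperDual (ρ := 0) (hA.gradient_pos k) (hR.inner_feasible k (R.N k) le_rfl).u_feasible
    (hR.D_u_zero_ne_bot k)

theorem isProperDual_w (hR : R.IsExecution P X p) (hA : R.GlobalAssumption P X) (k : ℕ) :
    (R.qp P X k).IsProperDual (R.wIn k (R.N k)) :=
  (R.qp P X k).isProperDual (ρ := 0) (hA.gradient_pos k) (hR.inner_feasible k (R.N k) le_rfl).w_feasible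
    (hR.D_w_zero_ne_bot k)

/-- The feasibility gap at the end of an inner loop is controlled by the reduction of the
linearized infeasibility. -/
theorem feasibility_gap (hR : R.IsExecution P X p) (hp : p.Valid) (hA : R.GlobalAssumption P X)
    (k : ℕ) : ∃ t : ℝ, (R.qp P X k).D (R.wIn k (R.N k)) 0 = t ∧ t ≤ P.v (R.x k) ∧
      p.βv * (P.v (R.x k) + R.ω k - max t 0) ≤ (R.qp P X k).deltaL (R.d k) 0 + R.ω k := by
  have hle := (hR.isProperDual_w hA k).D_le_l_zero (hA.gradient_pos k)
    (interior_subset hA.zero_mem_interior)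
    (hR.posDef k 0 ⟨le_rfl, (hR.ρPrev_pos hp k).le⟩)
  obtain ⟨t, ht, h⟩ := QPData.le_of_rv_ge (hR.ω_pos k) (hR.D_w_zero_ne_bot k) hle
    (hR.dust k).terminate.2.2
  rw [ht, l_zero_eq_v, EReal.coe_le_coe_iff] at hle
  rw [l_zero_eq_v] at h
  exact ⟨t, ht, hle, h⟩

/-- The duality gap at the end of an inner loop is controlled by the model reduction. -/
theorem optimality_gap (hR : R.IsExecution P X p) (hp : p.Valid) (hA : R.GlobalAssumption P X)
    (k : ℕ) : ∃ t : ℝ, (R.qp P X k).D (R.uIn k (R.N k)) (R.ρTilde k) = t ∧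
      p.βφ * (P.v (R.x k) + R.ω k - t) ≤ (R.qp P X k).deltaL (R.d k) (R.ρTilde k) + R.ω k := by
  have hT := hR.ρTilde_pos_le hp k
  have hH := hR.posDef k (R.ρTilde k) ⟨hT.1.le, hT.2⟩
  obtain ⟨t, ht, h⟩ := QPData.le_of_rphi_ge (hR.ω_pos k)
    (hR.inner_feasible k (R.N k) le_rfl).d_mem hp.βφ_mem.1
    (fun _ => (hR.isProperDual_u hA k).D_le_l_zero (hA.gradient_pos k)
      (interior_subset hA.zero_mem_interior) hH) (hR.dust k).terminate.1
  rw [l_zero_eq_v] at h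
  have := quadForm_nonneg hH (R.d k)
  exact ⟨t, ht, h.trans (by change _ - quadForm _ (R.d k) / 2 ≤ _; unfold ρTilde d at *; linarith)⟩

/-- Weak duality makes the left side of the feasibility gap estimate nonnegative. With the posterior
condition this yields Δl(dᵏ, ρₖ) ≥ -ωₖ. -/
theorem reduction_zero_nonneg (hR : R.IsExecution P X p) (hp : p.Valid)
    (hA : R.GlobalAssumption P X) (k : ℕ) : 0 ≤ (R.qp P X k).deltaL (R.d k) 0 + R.ω k := by
  obtain ⟨t, -, ht, h⟩ := hR.feasibility_gap hp hA k
  have hv : 0 ≤ P.v (R.x k) := Finset.sum_nonneg fun i _ => constraintViolation_nonneg _ _ _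
  have h1 : 0 ≤ P.v (R.x k) + R.ω k - max t 0 := by
    have := max_le ht hv
    linarith [hR.ω_pos k]
  exact (mul_nonneg hp.βv_mem.1.le h1).trans h

/-- The posterior strategy secures the model reduction condition. -/
theorem posteriorCondition (hR : R.IsExecution P X p) (hp : p.Valid) (k : ℕ) :
    R.PosteriorCondition P X p k (R.ρ k) := by
  by_cases h : R.PosteriorCondition P X p k (R.ρTilde k)
  · rw [(hR.psst k).keep h]; exact h
  have he := (hR.psst k).reduce h
  have hpos := (hR.psst k).pos
  have hq := quadForm_nonneg (hR.posDef k (R.ρ k)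
    ⟨hpos.le, (hR.psst k).le.trans (hR.ρTilde_pos_le hp k).2⟩) (R.d k)
  set q := quadForm ((R.qp P X k).H (R.ρ k)) (R.d k)
  set s : ℝ := inner ℝ (gradient P.f (R.x k)) (R.d k) with hs
  -- A zero denominator would give ρₖ = 0 by the convention for division. Clearing it, ρₖ s = (1 -
  -- βl)(Δl(dᵏ, 0) + ωₖ) - ρₖ q / 2, and the last term helps whatever the sign of the denominator.
  have hne : s + q / 2 ≠ 0 := by
    intro h0
    rw [h0, div_zero] at he
    exact hpos.ne' he
  have hm := (eq_div_iff hne).1 he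
  have := mul_nonneg hpos.le hq
  unfold PosteriorCondition
  rw [QPData.deltaL_eq]
  change _ - R.ρ k * s + _ ≥ _
  linarith

theorem α_mem (hR : R.IsExecution P X p) (hp : p.Valid) (k : ℕ) : 0 < R.α k ∧ R.α k ≤ 1 := by
  obtain ⟨s, hs, -⟩ := hR.line_search k
  rw [hs]
  exact ⟨pow_pos hp.γ_mem.1 _, pow_le_one₀ hp.γ_mem.1.le hp.γ_mem.2.le⟩

theorem decrease (hR : R.IsExecution P X p) (k : ℕ) :
    P.phi (R.x (k + 1)) (R.ρ k) - P.phi (R.x k) (R.ρ k) ≤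
      -p.θα * R.α k * (R.qp P X k).deltaL (R.d k) (R.ρ k) := by
  obtain ⟨s, hs, h, -⟩ := hR.line_search k
  rw [hR.x_succ, hs]
  exact h

/-- The penalty function agrees with its linear model up to a quadratic error. -/
theorem model_error (hR : R.IsExecution P X p) (hp : p.Valid) (hA : R.GlobalAssumption P X) :
    ∃ K : ℝ, 0 < K ∧ ∀ k, ∀ t : ℝ, 0 ≤ t → t ≤ 1 →
      P.phi (R.x k + t • R.d k) (R.ρ k) - P.phi (R.x k) (R.ρ k) ≤
        -t * (R.qp P X k).deltaL (R.d k) (R.ρ k) + K * t ^ 2 := by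
  obtain ⟨Ω, ho, hcv, hΩ, ⟨hf1, hf2, Mf, hMf⟩, hc⟩ := hA.bounded_derivatives
  choose hc1 hc2 Mc hMc using hc
  obtain ⟨B, hB⟩ := hA.compact.isBounded.exists_norm_le
  have hdB : ∀ k, ‖R.d k‖ ≤ B := fun k => hB _ (hR.inner_feasible k (R.N k) le_rfl).d_mem
  have hMf0 : 0 ≤ Mf := (abs_nonneg _).trans (hMf _ (hΩ 0).1).1
  have hMc0 : ∀ i, 0 ≤ Mc i := fun i => (abs_nonneg _).trans (hMc i _ (hΩ 0).1).1
  have hρ0 := (hR.psst 0).pos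
  have hK : 0 ≤ R.ρ 0 * (Mf * B ^ 2) + ∑ i, Mc i * B ^ 2 :=
    add_nonneg (by positivity) (Finset.sum_nonneg fun i _ => mul_nonneg (hMc0 i) (sq_nonneg _))
  refine ⟨R.ρ 0 * (Mf * B ^ 2) + ∑ i, Mc i * B ^ 2 + 1, by linarith, fun k t ht0 ht1 => ?_⟩
  have hf := abs_sub_linearization_le ho hcv hf1 hf2 (fun y hy => (hMf y hy).2.2) (hΩ k).1
    (hΩ k).2 ht0 ht1
  have hci := fun i => abs_sub_linearization_le ho hcv (hc1 i) (hc2 i)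
    (fun y hy => (hMc i y hy).2.2) (hΩ k).1 (hΩ k).2 ht0 ht1
  set d := R.d k
  set x := R.x k
  have hρ := (hR.psst k).pos
  have hfk : R.ρ k * (P.f (x + t • d) - P.f x - t * inner ℝ (gradient P.f x) d) ≤
      R.ρ 0 * (Mf * B ^ 2) * t ^ 2 := by
    calc _ ≤ R.ρ k * (Mf * ‖d‖ ^ 2 * t ^ 2) :=
          mul_le_mul_of_nonneg_left ((le_abs_self _).trans hf) hρ.le
      _ ≤ R.ρ 0 * (Mf * B ^ 2 * t ^ 2) := by
          gcongr
          · exact hR.antitone_ρ hp (Nat.zero_le k)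
          · exact hdB k
      _ = _ := by ring
  -- The 1-Lipschitz bound replaces cᵢ by its linearization at the cost of the Taylor error;
  -- convexity then compares step `t` with the full step.
  have hcall : ∀ i, constraintViolation P.mbar i (P.c i (x + t • d)) ≤
      constraintViolation P.mbar i (P.c i x) + t * (constraintViolation P.mbar i
        (P.c i x + inner ℝ (gradient (P.c i) x) d) - constraintViolation P.mbar i (P.c i x)) +
        Mc i * B ^ 2 * t ^ 2 := by
    intro i
    have h1 := constraintViolation_le_add_abs_sub P.mbar i (P.c i (x + t • d))
      (P.c i x + t * inner ℝ (gradient (P.c i) x) d)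
    have h2 := constraintViolation_convex P.mbar i (P.c i x)
      (inner ℝ (gradient (P.c i) x) d) ht0 ht1
    have h3 : Mc i * ‖d‖ ^ 2 * t ^ 2 ≤ Mc i * B ^ 2 * t ^ 2 := by
      gcongr
      · exact hMc0 i
      · exact hdB k
    have h4 := hci i
    rw [sub_sub] at h4
    linarith
  have hsum := Finset.sum_le_sum fun i (_ : i ∈ Finset.univ) => hcall i
  rw [Finset.sum_add_distrib, Finset.sum_add_distrib, ← Finset.mul_sum, ← Finset.sum_mul,
    Finset.sum_sub_distrib] at hsum
  have hL : (R.qp P X k).deltaL d (R.ρ k) = ∑ i, constraintViolation P.mbar i (P.c i x) -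
      (R.ρ k * inner ℝ (gradient P.f x) d + ∑ i, constraintViolation P.mbar i
        (P.c i x + inner ℝ (gradient (P.c i) x) d)) := by
    rw [QPData.deltaL, QPData.l_zero]; rfl
  rw [hL]
  unfold NLP.phi NLP.v
  have := sq_nonneg t
  linarith

/-- Steps are not too short relative to the model reduction. -/
theorem step_lower_bound (hR : R.IsExecution P X p) (hp : p.Valid) (hA : R.GlobalAssumption P X) :
    ∃ c : ℝ, 0 < c ∧ ∀ k, 0 < (R.qp P X k).deltaL (R.d k) (R.ρ k) →
      R.α k = 1 ∨ c * (R.qp P X k).deltaL (R.d k) (R.ρ k) ≤ R.α k := by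
  obtain ⟨K, hK, hmod⟩ := hR.model_error hp hA
  have hγ := hp.γ_mem
  have hθ := hp.θα_mem
  have h1θ : 0 < 1 - p.θα := by linarith [hθ.2]
  refine ⟨p.γ * (1 - p.θα) / K, div_pos (mul_pos hγ.1 h1θ) hK, fun k _ => ?_⟩
  obtain ⟨s, hs, -, hfail⟩ := hR.line_search k
  rcases s with _ | s
  · exact Or.inl (by simpa using hs)
  right
  -- The accepted step is γ^(s+1), so γ^s was rejected. Comparison with the model error gives (1 -
  -- θα) δ ≤ K γ^s.
  have hnot := hfail s (Nat.lt_succ_self s)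
  have ht := pow_pos hγ.1 s
  have hm := hmod k (p.γ ^ s) ht.le (pow_le_one₀ hγ.1.le hγ.2.le)
  unfold SufficientDecrease at hnot
  rw [not_le] at hnot
  set δ := (R.qp P X k).deltaL (R.d k) (R.ρ k)
  have h1 : (1 - p.θα) * δ * p.γ ^ s ≤ K * p.γ ^ s * p.γ ^ s := by nlinarith
  have h2 := mul_le_mul_of_nonneg_left (le_of_mul_le_mul_right h1 ht) hγ.1.le
  rw [hs, div_mul_eq_mul_div, div_le_iff₀ hK, pow_succ]
  linarith

/-- The model reductions vanish and the shifted penalty values converge. -/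
theorem tendsto_reduction (hR : R.IsExecution P X p) (hp : p.Valid)
    (hA : R.GlobalAssumption P X) :
    (∃ M : ℝ, (∀ k, |P.f (R.x k)| ≤ M) ∧
      ∃ L, Tendsto (fun k => R.ρ k * (P.f (R.x k) + M) + P.v (R.x k)) atTop (𝓝 L)) ∧
    Tendsto (fun k => (R.qp P X k).deltaL (R.d k) (R.ρ k)) atTop (𝓝 0) := by
  obtain ⟨Ω, -, -, hΩ, ⟨-, -, M, hM⟩, -⟩ := id hA.bounded_derivatives
  have hfM : ∀ k, |P.f (R.x k)| ≤ M := fun k => (hM _ (hΩ k).1).1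
  have hf0 : ∀ k, 0 ≤ P.f (R.x k) + M := fun k => by linarith [(abs_le.1 (hfM k)).1]
  obtain ⟨c, hc, hstep⟩ := hR.step_lower_bound hp hA
  have key := tendsto_of_quasi_decrease
    (Ψ := fun k => R.ρ k * (P.f (R.x k) + M) + P.v (R.x k)) (α := R.α)
    (δ := fun k => (R.qp P X k).deltaL (R.d k) (R.ρ k)) (ω := R.ω) (θ := p.θα) (c := c)
    (fun k => add_nonneg (mul_nonneg (hR.psst k).pos.le (hf0 k))
      (Finset.sum_nonneg fun i _ => constraintViolation_nonneg _ _ _))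
    hp.θα_mem.1 hp.θα_mem.2.le hc (fun k => (hR.α_mem hp k).1.le) (fun k => (hR.α_mem hp k).2)
    (fun k => (hR.ω_pos k).le) (hR.summable_ω hp)
    (fun k => by
      have h1 := hR.posteriorCondition hp k
      have h2 := mul_nonneg hp.βl_mem.1.le (hR.reduction_zero_nonneg hp hA k)
      unfold PosteriorCondition at h1
      linarith)
    (fun k => by
      have h1 := hR.decrease k
      have h2 := mul_le_mul_of_nonneg_right (hR.antitone_ρ hp (Nat.le_succ k)) (hf0 (k + 1))
      unfold NLP.phi at h1
      simp only [Nat.succ_eq_add_one] at h2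
      linarith) hstep
  exact ⟨⟨M, hfM, key.1⟩, key.2⟩

end IsExecution

end SQPRun

/-! ### Multipliers as limits of dual vectors -/

namespace SQPRun

variable {n m : ℕ} {R : SQPRun n m} {P : NLP n m} {X : Set (EuclideanSpace ℝ (Fin n))}
  {p : SQPParams}

/-- Dual vectors whose duality gap vanishes along a convergent subsequence of the iterates yield
multipliers at the limit. -/
theorem exists_multiplier_of_gap (hf : ContDiff ℝ 1 P.f) (hc : ∀ i, ContDiff ℝ 1 (P.c i))
    (ha : ∀ k i, 0 < ‖gradient (P.c i) (R.x k)‖) {r : ℝ} (hr : 0 < r)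
    (hX : Metric.closedBall 0 r ⊆ X) {L : ℝ} (hL : 0 < L) {s : ℕ → ℕ} (hs : StrictMono s)
    {xs : EuclideanSpace ℝ (Fin n)} (hx : Tendsto (R.x ∘ s) atTop (𝓝 xs)) {τ ε : ℕ → ℝ} {τs : ℝ}
    (hτ : Tendsto τ atTop (𝓝 τs)) (hε : Tendsto ε atTop (𝓝 0)) {u : ℕ → DualVec n m}
    (hu : ∀ k, (R.qp P X k).IsProperDual (u k))
    (hgap : ∀ᶠ k in atTop, ((R.qp P X (s k)).H (τ (s k))).PosDef ∧
      (∀ t ∈ spectrum ℝ ((R.qp P X (s k)).H (τ (s k))), t ≤ L) ∧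
      ((P.v (R.x (s k)) - ε (s k) : ℝ) : EReal) ≤ (R.qp P X (s k)).D (u (s k)) (τ (s k))) :
    ∃ z : Fin m → ℝ, τs • gradient P.f xs + ∑ i, z i • gradient (P.c i) xs = 0 ∧
      (∀ i, |z i| ≤ 1) ∧ (∀ i : Fin m, P.mbar ≤ i.val → 0 ≤ z i) ∧
      ∀ i, constraintViolation P.mbar i (P.c i xs) = z i * P.c i xs := by
  -- The ζᵢ lie in the compact cube `[-1, 1]^m`, so a further subsequence σ makes them converge.
  obtain ⟨z, hz, σ, hσ, hzσ⟩ := isCompact_Icc.tendsto_subseq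
    (s := Set.Icc (-1 : Fin m → ℝ) 1) (x := fun k i => (R.qp P X (s k)).zeta (u (s k)) i)
    (fun k => ⟨fun i => (abs_le.1 ((hu (s k)).abs_le i)).1,
      fun i => (abs_le.1 ((hu (s k)).abs_le i)).2⟩)
  have hzi := fun i => tendsto_pi_nhds.1 hzσ i
  have hsσ : Tendsto (s ∘ σ) atTop atTop := (hs.comp hσ).tendsto_atTop
  have hxσ : Tendsto (fun k => R.x (s (σ k))) atTop (𝓝 xs) := hx.comp hσ.tendsto_atTop
  have hτσ : Tendsto (fun k => τ (s (σ k))) atTop (𝓝 τs) := hτ.comp hsσ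
  have hεσ : Tendsto (fun k => ε (s (σ k))) atTop (𝓝 0) := hε.comp hsσ
  have hcσ : ∀ i, Tendsto (fun k => P.c i (R.x (s (σ k)))) atTop (𝓝 (P.c i xs)) := fun i =>
    ((hc i).continuous.tendsto xs).comp hxσ
  have hgσ : Tendsto (fun k => gradient P.f (R.x (s (σ k)))) atTop (𝓝 (gradient P.f xs)) :=
    (hf.continuous_gradient_of_one.tendsto xs).comp hxσ
  have hgcσ : ∀ i, Tendsto (fun k => gradient (P.c i) (R.x (s (σ k)))) atTop
      (𝓝 (gradient (P.c i) xs)) := fun i => ((hc i).continuous_gradient_of_one.tendsto xs).comp hxσ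
  have hgaps : ∀ᶠ k in atTop,
      ‖(u (s (σ k))).first - τ (s (σ k)) • gradient P.f (R.x (s (σ k)))‖ ^ 2 ≤
        2 * L * ε (s (σ k)) ∧ r * ‖(u (s (σ k))).last‖ ≤ ε (s (σ k)) ∧
      ∀ i, constraintViolation P.mbar i (P.c i (R.x (s (σ k)))) -
        (R.qp P X (s (σ k))).zeta (u (s (σ k))) i * P.c i (R.x (s (σ k))) ≤ ε (s (σ k)) := by
    filter_upwards [hσ.tendsto_atTop.eventually hgap] with k hk
    have h3 := hk.2.2
    rw [← l_zero_eq_v (R := R) (P := P) (X := X) (s (σ k)) 0] at h3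
    exact (hu (s (σ k))).gap_le (ha (s (σ k))) hr.le hX hk.1 hL hk.2.1 h3
  have hfirst : Tendsto (fun k => (u (s (σ k))).first - τ (s (σ k)) •
      gradient P.f (R.x (s (σ k)))) atTop (𝓝 0) := by
    have hb : Tendsto (fun k => √(2 * L * ε (s (σ k)))) atTop (𝓝 0) := by
      simpa using (hεσ.const_mul (2 * L)).sqrt
    refine squeeze_zero_norm' ?_ hb
    filter_upwards [hgaps] with k hk
    exact Real.le_sqrt_of_sq_le hk.1
  have hlast : Tendsto (fun k => (u (s (σ k))).last) atTop (𝓝 0) := by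
    have hb : Tendsto (fun k => ε (s (σ k)) / r) atTop (𝓝 0) := by simpa using hεσ.div_const r
    refine squeeze_zero_norm' ?_ hb
    filter_upwards [hgaps] with k hk
    rw [le_div_iff₀ hr, mul_comm]
    exact hk.2.1
  have hlim := ((hfirst.add (hτσ.smul hgσ)).add
    (tendsto_finsetSum Finset.univ fun i _ => (hzi i).smul (hgcσ i))).add hlast
  have hznn : ∀ i : Fin m, P.mbar ≤ i.val → 0 ≤ z i := fun i hi =>
    ge_of_tendsto' (hzi i) fun k => (hu (s (σ k))).nonneg i hi
  have hzabs : ∀ i, |z i| ≤ 1 := fun i => abs_le.2 ⟨hz.1 i, hz.2 i⟩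
  refine ⟨z, ?_, hzabs, hznn, fun i => le_antisymm ?_
    (mul_le_constraintViolation _ _ (hzabs i) (hznn i) _)⟩
  -- The converging expression is the left side of the dual constraint, hence identically zero.
  · have h0 := tendsto_nhds_unique hlim
      ((tendsto_const_nhds (x := (0 : EuclideanSpace ℝ (Fin n)))).congr fun k => by
      rw [← (hu (s (σ k))).sum_eq]
      simp only [sub_add_cancel]
      rfl)
    rwa [zero_add, add_zero] at h0
  · have hv := (((continuous_constraintViolation P.mbar i).tendsto _).comp (hcσ i)).sub
      ((hzi i).mul (hcσ i))
    have := le_of_tendsto_of_tendsto hv hεσ (hgaps.mono fun k hk => hk.2.2 i)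
    linarith

end SQPRun

/-! ### Feasibility and stationarity in terms of multipliers -/

namespace NLP

variable {n m : ℕ} {P : NLP n m} {xs : EuclideanSpace ℝ (Fin n)}

theorem isFeasible_iff : P.IsFeasible xs ↔ P.v xs = 0 := by
  unfold v
  rw [Finset.sum_eq_zero_iff_of_nonneg fun i _ => constraintViolation_nonneg _ _ _]
  refine forall_congr' fun i => ?_
  unfold constraintViolation
  split_ifs <;> simp

theorem IsFeasible.isStationaryForViolation (h : P.IsFeasible xs) :
    P.IsStationaryForViolation xs := by
  refine ⟨0, by simp, fun i => ?_⟩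
  have hi := h i
  split_ifs at hi ⊢ with hlt
  · simp [hi]
  · exact ⟨fun h => absurd h (not_lt.2 hi), fun _ => rfl, fun _ => ⟨le_rfl, zero_le_one⟩⟩

/-- Where cᵢ ≠ 0, cancelling cᵢ in `h3` leaves exactly the derivative of the violation; where cᵢ =
0, the bounds on `z` describe the subdifferential. -/
theorem isStationaryForViolation_of_multiplier {z : Fin m → ℝ}
    (h0 : ∑ i, z i • gradient (P.c i) xs = 0) (h1 : ∀ i, |z i| ≤ 1)
    (h2 : ∀ i : Fin m, P.mbar ≤ i.val → 0 ≤ z i)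
    (h3 : ∀ i, constraintViolation P.mbar i (P.c i xs) = z i * P.c i xs) :
    P.IsStationaryForViolation xs := by
  refine ⟨z, h0, fun i => ⟨fun hi => ?_, fun hi => ?_, fun hi => ⟨?_, (abs_le.1 (h1 i)).2⟩⟩⟩
  · have e : constraintViolation P.mbar i (P.c i xs) = 1 * P.c i xs := by
      unfold constraintViolation
      rw [abs_of_pos hi, max_eq_left hi.le, ite_self, one_mul]
    exact mul_right_cancel₀ hi.ne' ((h3 i).symm.trans e)
  · have e : constraintViolation P.mbar i (P.c i xs) =
        (if i.val < P.mbar then -1 else 0) * P.c i xs := by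
      unfold constraintViolation
      rw [abs_of_neg hi, max_eq_right hi.le]
      split_ifs <;> ring
    exact mul_right_cancel₀ hi.ne ((h3 i).symm.trans e)
  · split_ifs with hlt
    · exact (abs_le.1 (h1 i)).1
    · exact h2 i (not_lt.1 hlt)

theorem continuous_v (hc : ∀ i, ContDiff ℝ 1 (P.c i)) : Continuous P.v :=
  continuous_finsetSum _ fun i _ =>
    (continuous_constraintViolation P.mbar i).comp (hc i).continuous

end NLP

/-! ### Limit points of the iterates -/

namespace SQPRun

variable {n m : ℕ} {R : SQPRun n m} {P : NLP n m} {X : Set (EuclideanSpace ℝ (Fin n))}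
  {p : SQPParams}

namespace IsExecution

theorem tendsto_reduction_zero (hR : R.IsExecution P X p) (hp : p.Valid)
    (hA : R.GlobalAssumption P X) :
    Tendsto (fun k => (R.qp P X k).deltaL (R.d k) 0 + R.ω k) atTop (𝓝 0) := by
  have hω := (hR.summable_ω hp).tendsto_atTop_zero
  have h := ((hR.tendsto_reduction hp hA).2.add hω).div_const p.βl
  rw [add_zero, zero_div] at h
  refine squeeze_zero (hR.reduction_zero_nonneg hp hA) (fun k => ?_) h
  rw [le_div_iff₀ hp.βl_mem.1, mul_comm]
  exact hR.posteriorCondition hp k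

theorem isStationaryForViolation_of_clusterPt (hf : ContDiff ℝ 1 P.f)
    (hc : ∀ i, ContDiff ℝ 1 (P.c i)) (hR : R.IsExecution P X p) (hp : p.Valid)
    (hA : R.GlobalAssumption P X) {xs : EuclideanSpace ℝ (Fin n)}
    (hxs : MapClusterPt xs atTop R.x) : P.IsStationaryForViolation xs := by
  by_cases hfeas : P.IsFeasible xs
  · exact hfeas.isStationaryForViolation
  have hvpos : 0 < P.v xs := lt_of_le_of_ne
    (Finset.sum_nonneg fun i _ => constraintViolation_nonneg _ _ _)
    fun h => hfeas (NLP.isFeasible_iff.2 h.symm)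
  obtain ⟨s, hs, hx⟩ := hxs.tendsto_subseq
  obtain ⟨r, hr, hrX⟩ := Metric.nhds_basis_closedBall.mem_iff.1
    (mem_interior_iff_mem_nhds.1 hA.zero_mem_interior)
  obtain ⟨Λl, Λu, hΛ, hΛle, hspec⟩ := hA.eigenvalue_bounds
  have hε : Tendsto (fun k => ((R.qp P X k).deltaL (R.d k) 0 + R.ω k) / p.βv) atTop (𝓝 0) := by
    simpa using (hR.tendsto_reduction_zero hp hA).div_const p.βv
  have hv : Tendsto (fun k => P.v (R.x (s k))) atTop (𝓝 (P.v xs)) :=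
    ((NLP.continuous_v hc).tendsto xs).comp hx
  have hgap : ∀ᶠ k in atTop, ((R.qp P X (s k)).H 0).PosDef ∧
      (∀ t ∈ spectrum ℝ ((R.qp P X (s k)).H 0), t ≤ Λu) ∧
      ((P.v (R.x (s k)) - ((R.qp P X (s k)).deltaL (R.d (s k)) 0 + R.ω (s k)) / p.βv : ℝ) : EReal)
        ≤ (R.qp P X (s k)).D (R.wIn (s k) (R.N (s k))) 0 := by
    -- Since v(xs) > 0, v minus the gap is eventually positive. This excludes a nonpositive dual
    -- value, so the truncation at 0 in the ratio is harmless.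
    have hd := hv.sub (hε.comp hs.tendsto_atTop)
    rw [sub_zero] at hd
    filter_upwards [hd.eventually (lt_mem_nhds hvpos)] with k hk
    refine ⟨hR.posDef _ 0 ⟨le_rfl, (hR.ρPrev_pos hp _).le⟩,
      fun t ht => (hspec (s k) 0 ⟨le_rfl, (hR.psst 0).pos.le⟩ ht).2, ?_⟩
    obtain ⟨t, ht, -, h⟩ := hR.feasibility_gap hp hA (s k)
    rw [ht, EReal.coe_le_coe_iff]
    have h' : P.v (R.x (s k)) + R.ω (s k) - max t 0 ≤
        ((R.qp P X (s k)).deltaL (R.d (s k)) 0 + R.ω (s k)) / p.βv := by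
      rw [le_div_iff₀ hp.βv_mem.1, mul_comm]
      exact h
    have hω := hR.ω_pos (s k)
    simp only [Function.comp] at hk
    rcases le_total t 0 with h0 | h0
    · rw [max_eq_right h0] at h'
      linarith
    · rw [max_eq_left h0] at h'
      linarith
  obtain ⟨z, h0, h1, h2, h3⟩ := exists_multiplier_of_gap (τ := fun _ => 0) hf hc hA.gradient_pos hr
    hrX (hΛ.trans_le hΛle) hs hx tendsto_const_nhds hε (hR.isProperDual_w hA) hgap
  rw [zero_smul, zero_add] at h0
  exact NLP.isStationaryForViolation_of_multiplier h0 h1 h2 h3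

theorem isKKT_of_clusterPt (hf : ContDiff ℝ 1 P.f)
    (hc : ∀ i, ContDiff ℝ 1 (P.c i)) (hR : R.IsExecution P X p) (hp : p.Valid)
    (hA : R.GlobalAssumption P X) {ρs : ℝ} (hρs : 0 < ρs) (hρ : Tendsto R.ρ atTop (𝓝 ρs))
    {xs : EuclideanSpace ℝ (Fin n)} (hxs : MapClusterPt xs atTop R.x) (hv : P.v xs = 0) :
    P.IsKKT xs := by
  obtain ⟨s, hs, hx⟩ := hxs.tendsto_subseq
  obtain ⟨r, hr, hrX⟩ := Metric.nhds_basis_closedBall.mem_iff.1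
    (mem_interior_iff_mem_nhds.1 hA.zero_mem_interior)
  obtain ⟨Λl, Λu, hΛ, hΛle, hspec⟩ := hA.eigenvalue_bounds
  obtain ⟨Ω, -, -, hΩ, ⟨-, -, M, hM⟩, -⟩ := id hA.bounded_derivatives
  obtain ⟨B, hB⟩ := hA.compact.isBounded.exists_norm_le
  -- The bounds ρₖ₊₁ ≤ ρ̃ₖ₊₁ ≤ ρₖ squeeze the inner parameters.
  have hρT : Tendsto R.ρTilde atTop (𝓝 ρs) := by
    rw [← tendsto_add_atTop_iff_nat 1]
    exact tendsto_of_tendsto_of_tendsto_of_le_of_le ((tendsto_add_atTop_iff_nat 1).2 hρ) hρ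
      (fun k => (hR.psst (k + 1)).le) (fun k => (hR.ρTilde_pos_le hp (k + 1)).2)
  have hinner : ∀ k, |(inner ℝ (gradient P.f (R.x k)) (R.d k) : ℝ)| ≤ M * B := fun k => by
    rw [inner_gradient_eq, ← Real.norm_eq_abs]
    exact (ContinuousLinearMap.le_opNorm _ _).trans (mul_le_mul (hM _ (hΩ k).1).2.1
      (hB _ (hR.inner_feasible k (R.N k) le_rfl).d_mem) (norm_nonneg _)
      ((norm_nonneg (fderiv ℝ P.f (R.x k))).trans (hM _ (hΩ k).1).2.1))
  have hdiff : Tendsto (fun k => (R.ρTilde k - R.ρ k) * inner ℝ (gradient P.f (R.x k)) (R.d k))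
      atTop (𝓝 0) := by
    have h1 : Tendsto (fun k => |R.ρTilde k - R.ρ k| * (M * B)) atTop (𝓝 0) := by
      simpa using ((hρT.sub hρ).abs).mul_const (M * B)
    refine squeeze_zero_norm (fun k => ?_) h1
    rw [Real.norm_eq_abs, abs_mul]
    exact mul_le_mul_of_nonneg_left (hinner k) (abs_nonneg _)
  have hε : Tendsto (fun k => ((R.qp P X k).deltaL (R.d k) (R.ρTilde k) + R.ω k) / p.βφ)
      atTop (𝓝 0) := by
    have h1 := (((hR.tendsto_reduction hp hA).2.sub hdiff).add
      (hR.summable_ω hp).tendsto_atTop_zero).div_const p.βφ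
    rw [sub_zero, add_zero, zero_div] at h1
    refine h1.congr fun k => ?_
    rw [QPData.deltaL_eq _ _ (R.ρTilde k), QPData.deltaL_eq _ _ (R.ρ k)]
    change (_ - R.ρ k * inner ℝ (gradient P.f (R.x k)) (R.d k) - _ + _) / _ =
      (_ - R.ρTilde k * inner ℝ (gradient P.f (R.x k)) (R.d k) + _) / _
    ring
  have hgap : ∀ᶠ k in atTop, ((R.qp P X (s k)).H (R.ρTilde (s k))).PosDef ∧
      (∀ t ∈ spectrum ℝ ((R.qp P X (s k)).H (R.ρTilde (s k))), t ≤ Λu) ∧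
      ((P.v (R.x (s k)) -
        ((R.qp P X (s k)).deltaL (R.d (s k)) (R.ρTilde (s k)) + R.ω (s k)) / p.βφ : ℝ) : EReal)
        ≤ (R.qp P X (s k)).D (R.uIn (s k) (R.N (s k))) (R.ρTilde (s k)) := by
    -- Iteration 0 is skipped: ρ̃₀ may exceed ρ₀, up to which the eigenvalue bounds hold.
    filter_upwards [hs.tendsto_atTop.eventually (eventually_ge_atTop 1)] with k hk
    have hT := hR.ρTilde_pos_le hp (s k)
    have hle : R.ρTilde (s k) ≤ R.ρ 0 := by
      obtain ⟨j, hj⟩ := Nat.exists_eq_add_of_le' hk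
      rw [hj] at hT ⊢
      exact hT.2.trans (hR.antitone_ρ hp (Nat.zero_le j))
    refine ⟨hR.posDef _ _ ⟨hT.1.le, hT.2⟩, fun t ht => (hspec (s k) _ ⟨hT.1.le, hle⟩ ht).2, ?_⟩
    obtain ⟨t, ht, h⟩ := hR.optimality_gap hp hA (s k)
    rw [ht, EReal.coe_le_coe_iff]
    have h' : P.v (R.x (s k)) + R.ω (s k) - t ≤
        ((R.qp P X (s k)).deltaL (R.d (s k)) (R.ρTilde (s k)) + R.ω (s k)) / p.βφ := by
      rw [le_div_iff₀ hp.βφ_mem.1, mul_comm]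
      exact h
    have hω := hR.ω_pos (s k)
    linarith
  obtain ⟨z, h0, -, h2, h3⟩ := exists_multiplier_of_gap hf hc hA.gradient_pos hr
    hrX (hΛ.trans_le hΛle) hs hx hρT hε (hR.isProperDual_u hA) hgap
  have hvi := (Finset.sum_eq_zero_iff_of_nonneg
    fun i _ => constraintViolation_nonneg P.mbar i (P.c i xs)).1 hv
  -- Division by ρs normalizes the coefficient of ∇f. Complementarity holds because z i * c i equals
  -- the violation, which is zero.
  refine ⟨NLP.isFeasible_iff.2 hv, fun i => ρs⁻¹ * z i, ?_,
    fun i hi => mul_nonneg (inv_nonneg.2 hρs.le) (h2 i hi), fun i => ?_⟩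
  · have := congrArg (fun y => ρs⁻¹ • y) h0
    simpa only [smul_add, Finset.smul_sum, smul_smul, inv_mul_cancel₀ hρs.ne', one_smul,
      smul_zero] using this
  · rw [mul_assoc, ← h3 i, hvi i (Finset.mem_univ i), mul_zero]

/-- When the penalty parameter vanishes, the infeasibility converges. -/
theorem exists_tendsto_v (hR : R.IsExecution P X p) (hp : p.Valid)
    (hA : R.GlobalAssumption P X) (hρ : Tendsto R.ρ atTop (𝓝 0)) :
    ∃ L, Tendsto (fun k => P.v (R.x k)) atTop (𝓝 L) := by
  obtain ⟨⟨M, hM, L, hL⟩, -⟩ := hR.tendsto_reduction hp hA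
  have h0 : Tendsto (fun k => R.ρ k * (P.f (R.x k) + M)) atTop (𝓝 0) := by
    have h1 : Tendsto (fun k => R.ρ k * (M + M)) atTop (𝓝 0) := by
      simpa using hρ.mul_const (M + M)
    refine squeeze_zero (fun k => mul_nonneg (hR.psst k).pos.le ?_) (fun k =>
      mul_le_mul_of_nonneg_left ?_ (hR.psst k).pos.le) h1
    · linarith [(abs_le.1 (hM k)).1]
    · linarith [(abs_le.1 (hM k)).2]
  exact ⟨L - 0, (hL.sub h0).congr fun k => by ring⟩

end IsExecution

end SQPRun

end Convergence

theorem mainTheorem2 {n m : ℕ} (P : NLP n m)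
    (hf : ContDiff ℝ 1 P.f) (hc : ∀ i, ContDiff ℝ 1 (P.c i))
    (X : Set (EuclideanSpace ℝ (Fin n)))
    (p : SQPParams) (hp : p.Valid)
    (R : SQPRun n m) (hR : R.IsExecution P X p) (hA : R.GlobalAssumption P X) :
    (∀ xs : EuclideanSpace ℝ (Fin n), MapClusterPt xs Filter.atTop R.x →
      P.IsStationaryForViolation xs ∧ (P.IsFeasible xs ∨ P.IsInfeasibleStationary xs)) ∧
    (∀ ρs : ℝ, 0 < ρs → Filter.Tendsto R.ρ Filter.atTop (nhds ρs) →
      Filter.Tendsto (fun k => P.v (R.x k)) Filter.atTop (nhds 0) →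
      ∀ xs : EuclideanSpace ℝ (Fin n), MapClusterPt xs Filter.atTop R.x →
        P.v xs = 0 → P.IsKKT xs) ∧
    (Filter.Tendsto R.ρ Filter.atTop (nhds 0) →
      (∀ xs : EuclideanSpace ℝ (Fin n), MapClusterPt xs Filter.atTop R.x → P.IsFeasible xs) ∨
      (∀ xs : EuclideanSpace ℝ (Fin n), MapClusterPt xs Filter.atTop R.x →
        ¬ P.IsFeasible xs)) := by
  refine ⟨fun xs hxs => ?_, fun ρs hρs hρ _ xs hxs hv =>
    hR.isKKT_of_clusterPt hf hc hp hA hρs hρ hxs hv, fun hρ => ?_⟩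
  · have h := hR.isStationaryForViolation_of_clusterPt hf hc hp hA hxs
    exact ⟨h, (em (P.IsFeasible xs)).imp_right fun hn => ⟨hn, h⟩⟩
  · obtain ⟨L, hL⟩ := hR.exists_tendsto_v hp hA hρ
    -- Continuity of v forces the common value L at every limit point, so feasibility depends only
    -- on whether L = 0.
    have hlim : ∀ xs, MapClusterPt xs Filter.atTop R.x → P.v xs = L := by
      intro xs hxs
      obtain ⟨s, hs, hx⟩ := hxs.tendsto_subseq
      exact tendsto_nhds_unique (((NLP.continuous_v hc).tendsto xs).comp hx)
        (hL.comp hs.tendsto_atTop)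
    rcases eq_or_ne L 0 with h0 | h0
    · exact Or.inl fun xs hxs => NLP.isFeasible_iff.2 ((hlim xs hxs).trans h0)
    · exact Or.inr fun xs hxs hfeas => h0 ((hlim xs hxs).symm.trans (NLP.isFeasible_iff.1 hfeas))
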